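/- Let $\Phi_F>0$ and let $K\in C^2(\mathbb R)$ have bounded $K'$ and $K''$ on $\mathbb R$ and satisfy $K>0$ on $[0,\Phi_F]$. Call $q$ *admissible* if $q\in C^1[0,1]$ is non-decreasing, $q(0)=0$, $q(1)=\Phi_F$, $q'(1)>K(\Phi_F)$ and $$q'(1)-q'(0)=K(\Phi_F)-K(0).$$ For $0<T\le+\infty$, a *classical solution on $[0,T)$ with initial datum $q$* is a pair $(Q,N)$ with $Q\in C^1([0,T)\times[0,1])$ non-decreasing in $\eta$ and $N\in C[0,T)$ positive, such that for all $\tau\in[0,T)$ $$\partial_\tau Q+\partial_\eta Q=\frac1{N(\tau)}+K(Q)\ \ (0<\eta<1),\qquad Q(\tau,0)=0,\qquad \frac1{N(\tau)}=\partial_\eta Q(\tau,1)-K(\Phi_F),\qquad K(\Phi_F)<\partial_\eta Q(\tau,1)<+\infty,$$ and $Q(0,\eta)=q(\eta)$ for $\eta\in[0,1]$. Derivatives at boundary points are one-sided. A classical solution on $[0,\tau^*)$ is *maximal* if every classical solution with the same datum lives on some $[0,T)$ with $T\le\tau^*$; $\tau^*$ is then the maximal existence time. Then the following hold. 1. (Well-posedness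 and blow-up.) For every admissible $q$ there are $\tau^*\in(0,+\infty]$ and a maximal classical solution $(Q,N)$ on $[0,\tau^*)$. It is unique: every classical solution with datum $q$ on an interval $[0,T)$ has $T\le\tau^*$ and coincides with $(Q,N)$ on $[0,T)$. If $\tau^*<+\infty$, then $\lim_{\tau\to(\tau^*)^-}N(\tau)=+\infty$. 2. (Continuous dependence.) Let $(q_\varepsilon)_{\varepsilon\ge0}$ be admissible with $q_\varepsilon\to q_0$ in $C^1[0,1]$ as $\varepsilon\to0^+$, and let $(Q_\varepsilon,N_\varepsilon)$ be the corresponding maximal classical solutions, with maximal existence times $\tau^*_\varepsilon$. Then $\liminf_{\varepsilon\to0^+}\tau^*_\varepsilon\ge\tau^*_0$, and for every $0<T<\tau^*_0$, as $\varepsilon\to0^+$, $N_\varepsilon\to N_0$ in $C[0,T]$ and $Q_\varepsilon(T,\cdot)\to Q_0(T,\cdot)$ in $C^1[0,1]$. 3. (Regularity.) If $q$ is admissible, $q\in C^2[0,1]$ and $$q''(1)-q''(0)=K'(\Phi_F)\,q'(1)-K'(0)\,q'(0),$$ then the maximal classical solution satisfies $N\in C^1[0,\tau^*)$ and $Q\in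 C^2([0,\tau^*)\times[0,1])$. -/

import Mathlib

open Set Filter Topology

/-- Standing assumption on the phase response function `K` with firing phase `Φ`:
`K` is `C²` on `ℝ`, `K'` and `K''` are bounded on `ℝ`, and `K > 0` on `[0, Φ]`. -/
structure IsPhaseResponse (Φ : ℝ) (K : ℝ → ℝ) : Prop where
  contDiff : ContDiff ℝ 2 K
  bounded_deriv : ∃ C : ℝ, ∀ x, |deriv K x| ≤ C
  bounded_deriv2 : ∃ C : ℝ, ∀ x, |iteratedDeriv 2 K x| ≤ C
  pos : ∀ φ ∈ Icc (0 : ℝ) Φ, 0 < K φ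

/-- The time interval `[0, T)`, for an extended real `T` (so `T = ⊤` gives `[0, ∞)`). -/
def timeInterval (T : EReal) : Set ℝ := {τ : ℝ | 0 ≤ τ ∧ (τ : EReal) < T}

/-- The spatial derivative `∂_η q` on `[0, 1]` (one-sided at the end points). -/
noncomputable def dEta (q : ℝ → ℝ) (η : ℝ) : ℝ := derivWithin q (Icc 0 1) η

/-- The time derivative `∂_τ Q` on `[0, T) × [0, 1]` (one-sided at `τ = 0`). -/
noncomputable def dTau (T : EReal) (Q : ℝ → ℝ → ℝ) (τ η : ℝ) : ℝ :=
  derivWithin (fun s => Q s η) (timeInterval T) τ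

/-- Assumption on the initial data: `C¹[0,1]`, non-decreasing, with the right boundary values,
`q'(1) > K(Φ)`, and compatible with the boundary conditions to first order. -/
structure IsAdmissibleData (Φ : ℝ) (K : ℝ → ℝ) (q : ℝ → ℝ) : Prop where
  contDiffOn : ContDiffOn ℝ 1 q (Icc 0 1)
  monotoneOn : MonotoneOn q (Icc 0 1)
  at_zero : q 0 = 0
  at_one : q 1 = Φ
  slope_gt : K Φ < dEta q 1
  compat : dEta q 1 - dEta q 0 = K Φ - K 0

/-- Additional second-order assumption on the initial data. -/
structure IsSecondOrderCompatible (Φ : ℝ) (K : ℝ → ℝ) (q : ℝ → ℝ) : Prop where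
  contDiffOn : ContDiffOn ℝ 2 q (Icc 0 1)
  compat : iteratedDerivWithin 2 q (Icc 0 1) 1 - iteratedDerivWithin 2 q (Icc 0 1) 0
    = deriv K Φ * dEta q 1 - deriv K 0 * dEta q 0

/-- `(Q, N)` is a classical solution on `[0, T)` with initial datum `q`. The values of `Q` outside
`[0, T) × [0, 1]` and of `N` outside `[0, T)` play no role. -/
structure IsClassicalSolution (Φ : ℝ) (K : ℝ → ℝ) (q : ℝ → ℝ) (T : EReal)
    (Q : ℝ → ℝ → ℝ) (N : ℝ → ℝ) : Prop where
  T_pos : 0 < T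
  contDiffOn : ContDiffOn ℝ 1 (fun p : ℝ × ℝ => Q p.1 p.2) (timeInterval T ×ˢ Icc 0 1)
  monotoneOn : ∀ τ ∈ timeInterval T, MonotoneOn (Q τ) (Icc 0 1)
  continuousOn : ContinuousOn N (timeInterval T)
  N_pos : ∀ τ ∈ timeInterval T, 0 < N τ
  transport : ∀ τ ∈ timeInterval T, ∀ η ∈ Ioo (0 : ℝ) 1,
    dTau T Q τ η + dEta (Q τ) η = 1 / N τ + K (Q τ η)
  boundary : ∀ τ ∈ timeInterval T, Q τ 0 = 0
  firing_rate : ∀ τ ∈ timeInterval T, 1 / N τ = dEta (Q τ) 1 - K Φ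
  initial : ∀ η ∈ Icc (0 : ℝ) 1, Q 0 η = q η
  constraint : ∀ τ ∈ timeInterval T, K Φ < dEta (Q τ) 1

/-- `(Q, N)` is a classical solution on `[0, T)`, and no classical solution with the same initial
datum lives on a longer interval: `T` is the maximal existence time. -/
def IsMaximalSolution (Φ : ℝ) (K : ℝ → ℝ) (q : ℝ → ℝ) (T : EReal)
    (Q : ℝ → ℝ → ℝ) (N : ℝ → ℝ) : Prop :=
  IsClassicalSolution Φ K q T Q N ∧
    ∀ (T' : EReal) (Q' : ℝ → ℝ → ℝ) (N' : ℝ → ℝ), IsClassicalSolution Φ K q T' Q' N' → T' ≤ T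

/-- Convergence in `C¹[0,1]` of a family `f ε` to `g` as `ε → 0⁺`: uniform convergence on `[0,1]` of
the functions and of their derivatives. -/
def TendstoC1 (f : ℝ → ℝ → ℝ) (g : ℝ → ℝ) : Prop :=
  TendstoUniformlyOn f g (𝓝[>] 0) (Icc 0 1) ∧
    TendstoUniformlyOn (fun ε => dEta (f ε)) (dEta g) (𝓝[>] 0) (Icc 0 1)

/-! Put u = 1/N. Along a line η - τ = y the unknown Q solves the ODE X' = u(τ) + K(X), starting from
q(y) at time 0 if 0 ≤ y ≤ 1 and from the boundary value 0 at time -y if y ≤ 0. So u and q determine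
Q (`profile`) and its slope (`profileDeriv`), which is the slope at entry times exp ∫ K'(Q) along
the line. The entry slope is q'(y) for y ≥ 0 and u(-y) + K(0) for y ≤ 0, because ∂_τ Q vanishes on η
= 0; first-order compatibility makes the two agree at y = 0.

The firing-rate condition is then a single fixed point equation, u(τ) = `profileDeriv K u q τ 1` -
K(Φ). Its right side contains u(τ - 1), for τ ≥ 1, through the entry slope, and u up to time τ only
inside the exponent. It makes sense for u of any sign, and `exists_inflow` solves it on the whole
half-line. Entry slopes grow at most exponentially, so the Lipschitz constant of the exponential
factor does too; the weight w = exp(l exp(kt)), with w' = l k exp(kt) w, compensates for this and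
also for the delay, and the map contracts by 1/2 (`abs_profileDeriv_one_sub_le`).

The profile is a classical solution as long as u > 0 (`isClassicalSolution_profile`), and every
classical solution is a profile (`IsClassicalSolution.eq_profile`). Hence τ* is the first zero of u,
if any, and N = 1/u blows up there. The same weighted estimate with two data gives Lipschitz
dependence on compact time intervals (`exists_stability_const`): uniqueness when the data coincide,
and in general closeness of the inflows, hence persistence of u > 0 and lower semicontinuity of τ*.

Regularity is a bootstrap: if `labelDeriv` is C¹ on [-b, 1], then u is C¹ on [0, b + 1], which makes
`labelDeriv` C¹ on [-(b + 1), 0]. Second-order compatibility allows gluing at y = 0. -/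

/-! ### A fixed point theorem on weighted spaces of continuous functions -/

/-- Picard iterates converge geometrically in sup |u|/w. Only the first increment needs a finite
weighted norm, so members of `S` may have infinite norm; this is what allows `S` to be all
continuous functions as well as a set cut out by growth bounds. -/
theorem exists_fixedPoint_of_weighted_contraction {w : ℝ → ℝ} (hw : Continuous w)
    (hw0 : ∀ t, 0 < w t) {S : Set (ℝ → ℝ)} (hSc : ∀ u ∈ S, Continuous u)
    (hScl : ∀ (u : ℕ → ℝ → ℝ) (v : ℝ → ℝ), (∀ n, u n ∈ S) → Continuous v →
      (∀ t, Tendsto (fun n => u n t) atTop (𝓝 (v t))) → v ∈ S)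
    {F : (ℝ → ℝ) → ℝ → ℝ} (hF : ∀ u ∈ S, F u ∈ S) {u₀ : ℝ → ℝ} (h0 : u₀ ∈ S) {C : ℝ}
    (hC : ∀ t, |F u₀ t - u₀ t| ≤ C * w t)
    (hcontr : ∀ u ∈ S, ∀ v ∈ S, ∀ s > 0, (∀ t, |u t - v t| ≤ s * w t) →
      ∀ t, |F u t - F v t| ≤ s / 2 * w t) :
    ∃ u ∈ S, F u = u := by
  -- The contraction hypothesis asks for s > 0, so `C` is enlarged to a positive constant.
  obtain ⟨D, hD, hCD⟩ : ∃ D > 0, C ≤ D := ⟨max C 1, by positivity, le_max_left _ _⟩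
  set U : ℕ → ℝ → ℝ := fun n => F^[n] u₀ with hU
  have hUsucc : ∀ n, U (n + 1) = F (U n) := fun n => Function.iterate_succ_apply' F n u₀
  have hUS : ∀ n, U n ∈ S := by
    intro n
    induction n with
    | zero => simpa [hU] using h0
    | succ n ih => rw [hUsucc]; exact hF _ ih
  have hstep : ∀ n t, |U (n + 1) t - U n t| ≤ D / 2 ^ n * w t := by
    intro n
    induction n with
    | zero =>
      intro t
      have h := hC t
      have : C * w t ≤ D * w t := mul_le_mul_of_nonneg_right hCD (hw0 t).le
      simpa [hU] using h.trans this
    | succ n ih =>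
      intro t
      have h := hcontr _ (hUS (n + 1)) _ (hUS n) (D / 2 ^ n) (by positivity) ih t
      rw [hUsucc (n + 1)]
      nth_rewrite 2 [hUsucc n]
      rwa [pow_succ, ← div_div]
  have hdist : ∀ t n, dist (U n t) (U (n + 1) t) ≤ 2 * D * w t / 2 / 2 ^ n := by
    intro t n
    rw [dist_comm, Real.dist_eq]
    refine (hstep n t).trans (le_of_eq ?_)
    field_simp
  have hlim : ∀ t, ∃ a, Tendsto (fun n => U n t) atTop (𝓝 a) := fun t =>
    cauchySeq_tendsto_of_complete (cauchySeq_of_le_geometric_two (hdist t))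
  choose v hv using hlim
  have hbd : ∀ n t, |U n t - v t| ≤ 2 * D / 2 ^ n * w t := by
    intro n t
    have := dist_le_of_le_geometric_two_of_tendsto (hdist t) (hv t) n
    rw [Real.dist_eq] at this
    refine this.trans (le_of_eq ?_)
    ring
  have h2 : Tendsto (fun n : ℕ => 2 * D / 2 ^ n) atTop (𝓝 0) :=
    tendsto_const_nhds.div_atTop (tendsto_pow_atTop_atTop_of_one_lt (by norm_num))
  have hvc : Continuous v := by
    have hunif : TendstoUniformly (fun n t => U n t / w t) (fun t => v t / w t) atTop := by
      rw [Metric.tendstoUniformly_iff]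
      intro ε hε
      filter_upwards [h2.eventually (gt_mem_nhds hε)] with n hn t
      rw [dist_comm, Real.dist_eq, ← sub_div, abs_div, abs_of_pos (hw0 t), div_lt_iff₀ (hw0 t)]
      exact (hbd n t).trans_lt (mul_lt_mul_of_pos_right hn (hw0 t))
    have hc : Continuous fun t => v t / w t :=
      hunif.continuous (Frequently.of_forall fun n =>
        (hSc _ (hUS n)).div hw fun t => (hw0 t).ne')
    have : v = fun t => v t / w t * w t := by
      ext t
      rw [div_mul_cancel₀ _ (hw0 t).ne']
    rw [this]
    exact hc.mul hw
  have hvS : v ∈ S := hScl U v hUS hvc hv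
  refine ⟨v, hvS, ?_⟩
  ext t
  have h3 : Tendsto (fun n => U (n + 1) t) atTop (𝓝 (F v t)) := by
    rw [tendsto_iff_dist_tendsto_zero]
    refine squeeze_zero (fun _ => dist_nonneg) (fun n => ?_)
      (by simpa using (h2.div_const 2).mul_const (w t))
    rw [Real.dist_eq, hUsucc]
    exact hcontr _ (hUS n) _ hvS (2 * D / 2 ^ n) (by positivity) (hbd n) t
  exact tendsto_nhds_unique h3 ((tendsto_add_atTop_iff_nat 1).2 (hv t))

/-! ### Calculus lemmas -/

/-- Carathéodory's criterion: off x, the difference quotient is `E` itself. It serves wherever an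
increment has an exact integral formula. -/
theorem HasDerivAt.of_eq_add_sub_mul {f E : ℝ → ℝ} {x : ℝ}
    (hf : ∀ y, f y = f x + (y - x) * E y) (hE : ContinuousAt E x) : HasDerivAt f (E x) x := by
  rw [hasDerivAt_iff_tendsto_slope]
  refine (hE.tendsto.mono_left nhdsWithin_le_nhds).congr' ?_
  filter_upwards [self_mem_nhdsWithin] with y hy
  have : y - x ≠ 0 := sub_ne_zero.2 hy
  rw [slope_def_field, hf y]
  field_simp
  ring

theorem hasStrictFDerivAt_of_continuous_partials {f f₁ f₂ : ℝ → ℝ → ℝ}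
    (h₁ : ∀ t x, HasDerivAt (fun s => f s x) (f₁ t x) t)
    (h₂ : ∀ t x, HasDerivAt (f t) (f₂ t x) x)
    (c₁ : Continuous fun p : ℝ × ℝ => f₁ p.1 p.2)
    (c₂ : Continuous fun p : ℝ × ℝ => f₂ p.1 p.2) (p : ℝ × ℝ) :
    HasStrictFDerivAt (fun p : ℝ × ℝ => f p.1 p.2)
      ((ContinuousLinearMap.toSpanSingleton ℝ (f₁ p.1 p.2)).coprod
        (ContinuousLinearMap.toSpanSingleton ℝ (f₂ p.1 p.2))) p := by
  have hc : Continuous fun a : ℝ => ContinuousLinearMap.toSpanSingleton ℝ a :=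
    (ContinuousLinearMap.toSpanSingletonCLE (𝕜 := ℝ) (E := ℝ)).continuous
  exact hasStrictFDerivAt_uncurry_coprod (𝕜 := ℝ) (u := p) (f := f)
    (f₁ := fun t x => ContinuousLinearMap.toSpanSingleton ℝ (f₁ t x))
    (f₂ := fun t x => ContinuousLinearMap.toSpanSingleton ℝ (f₂ t x))
    (Eventually.of_forall fun v => (h₁ v.1 v.2).hasFDerivAt)
    (Eventually.of_forall fun v => (h₂ v.1 v.2).hasFDerivAt)
    (hc.comp c₁).continuousAt (hc.comp c₂).continuousAt

theorem contDiff_one_of_continuous_partials {f f₁ f₂ : ℝ → ℝ → ℝ}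
    (h₁ : ∀ t x, HasDerivAt (fun s => f s x) (f₁ t x) t)
    (h₂ : ∀ t x, HasDerivAt (f t) (f₂ t x) x)
    (c₁ : Continuous fun p : ℝ × ℝ => f₁ p.1 p.2)
    (c₂ : Continuous fun p : ℝ × ℝ => f₂ p.1 p.2) :
    ContDiff ℝ 1 (fun p : ℝ × ℝ => f p.1 p.2) := by
  have hc : Continuous fun a : ℝ => ContinuousLinearMap.toSpanSingleton ℝ a :=
    (ContinuousLinearMap.toSpanSingletonCLE (𝕜 := ℝ) (E := ℝ)).continuous
  rw [contDiff_one_iff_hasFDerivAt]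
  refine ⟨_, ?_, fun p =>
    (hasStrictFDerivAt_of_continuous_partials h₁ h₂ c₁ c₂ p).hasFDerivAt⟩
  exact (hc.comp c₁).continuousLinearMapCoprod (hc.comp c₂)

theorem eq_mul_exp_integral_of_hasDerivAt {D a : ℝ → ℝ} (ha : Continuous a)
    (hD : ∀ t, HasDerivAt D (a t * D t) t) (s t : ℝ) :
    D t = D s * Real.exp (∫ r in s..t, a r) := by
  have hI : ∀ t, HasDerivAt (fun t => ∫ r in s..t, a r) (a t) t := fun t =>
    intervalIntegral.integral_hasDerivAt_right (ha.intervalIntegrable _ _)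
      (ha.stronglyMeasurableAtFilter _ _) ha.continuousAt
  have hG : ∀ t, HasDerivAt (fun t => D t * Real.exp (-∫ r in s..t, a r)) 0 t := by
    intro t
    exact ((hD t).fun_mul (hI t).fun_neg.exp).congr_deriv (by ring)
  have hconst := is_const_of_deriv_eq_zero (fun t => (hG t).differentiableAt)
    (fun t => (hG t).deriv) t s
  simp only [intervalIntegral.integral_same, neg_zero, Real.exp_zero, mul_one] at hconst
  rw [← hconst, mul_assoc, ← Real.exp_add]
  simp

/-! ### Trajectories of `X' = u(t) + K(X)` -/

/-- `K` is `C²`, and `M` bounds `K'` and is a Lipschitz constant for `K'`. -/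
structure IsBoundedC2 (K : ℝ → ℝ) (M : ℝ) : Prop where
  contDiff : ContDiff ℝ 2 K
  abs_deriv_le : ∀ x, |deriv K x| ≤ M
  deriv_lipschitz : ∀ x y, |deriv K x - deriv K y| ≤ M * |x - y|

namespace IsBoundedC2

variable {K : ℝ → ℝ} {M : ℝ}

theorem nonneg (hK : IsBoundedC2 K M) : 0 ≤ M := (abs_nonneg _).trans (hK.abs_deriv_le 0)

theorem continuous (hK : IsBoundedC2 K M) : Continuous K := hK.contDiff.continuous

theorem hasDerivAt (hK : IsBoundedC2 K M) (x : ℝ) : HasDerivAt K (deriv K x) x :=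
  (hK.contDiff.differentiable (by norm_num) x).hasDerivAt

theorem contDiff_deriv (hK : IsBoundedC2 K M) : ContDiff ℝ 1 (deriv K) :=
  hK.contDiff.deriv' (n := 1)

theorem continuous_deriv (hK : IsBoundedC2 K M) : Continuous (deriv K) :=
  hK.contDiff_deriv.continuous

theorem hasDerivAt_deriv (hK : IsBoundedC2 K M) (x : ℝ) :
    HasDerivAt (deriv K) (deriv (deriv K) x) x :=
  (hK.contDiff_deriv.differentiable (by norm_num) x).hasDerivAt

theorem continuous_deriv_deriv (hK : IsBoundedC2 K M) : Continuous (deriv (deriv K)) :=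
  hK.contDiff_deriv.continuous_deriv (by norm_num)

theorem lipschitz (hK : IsBoundedC2 K M) (x y : ℝ) : |K x - K y| ≤ M * |x - y| := by
  have := Convex.norm_image_sub_le_of_norm_deriv_le (f := K) (s := univ) (C := M)
    (fun z _ => (hK.hasDerivAt z).differentiableAt) (fun z _ => hK.abs_deriv_le z) convex_univ
    (mem_univ y) (mem_univ x)
  simpa using this

theorem lipschitzWith (hK : IsBoundedC2 K M) (c : ℝ) :
    LipschitzWith M.toNNReal (fun x => c + K x) := by
  refine LipschitzWith.of_dist_le_mul fun x y => ?_
  rw [Real.dist_eq, Real.dist_eq, Real.coe_toNNReal _ hK.nonneg, add_sub_add_left_eq_sub]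
  exact hK.lipschitz x y

end IsBoundedC2

theorem IsPhaseResponse.exists_isBoundedC2 {Φ : ℝ} {K : ℝ → ℝ} (h : IsPhaseResponse Φ K) :
    ∃ M, IsBoundedC2 K M := by
  obtain ⟨A, hA⟩ := h.bounded_deriv
  obtain ⟨B, hB⟩ := h.bounded_deriv2
  have hB' : ∀ x, |deriv (deriv K) x| ≤ B := by
    intro x
    have := hB x
    rwa [iteratedDeriv_succ, iteratedDeriv_one] at this
  have hd : ContDiff ℝ 1 (deriv K) := h.contDiff.deriv' (n := 1)
  refine ⟨max A B, h.contDiff, fun x => (hA x).trans (le_max_left _ _), fun x y => ?_⟩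
  have := Convex.norm_image_sub_le_of_norm_deriv_le (f := deriv K) (s := univ) (C := max A B)
    (fun z _ => hd.differentiable (by norm_num) z)
    (fun z _ => (hB' z).trans (le_max_right _ _)) convex_univ (mem_univ y) (mem_univ x)
  simpa using this

/-- The mean slope `∫₀¹ K'(x + θ (y - x)) dθ` of `K` between `x` and `y`. -/
noncomputable def meanSlope (K : ℝ → ℝ) (x y : ℝ) : ℝ :=
  ∫ θ in (0 : ℝ)..1, deriv K (x + θ * (y - x))

section MeanSlope

variable {K : ℝ → ℝ} {M : ℝ}

theorem meanSlope_self (K : ℝ → ℝ) (x : ℝ) : meanSlope K x x = deriv K x := by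
  simp [meanSlope]

theorem continuous_meanSlope (hK : IsBoundedC2 K M) :
    Continuous fun p : ℝ × ℝ => meanSlope K p.1 p.2 := by
  refine intervalIntegral.continuous_parametric_intervalIntegral_of_continuous'
    (f := fun (p : ℝ × ℝ) θ => deriv K (p.1 + θ * (p.2 - p.1))) ?_ 0 1
  exact hK.continuous_deriv.comp (by fun_prop)

theorem abs_meanSlope_le (hK : IsBoundedC2 K M) (x y : ℝ) : |meanSlope K x y| ≤ M := by
  have := intervalIntegral.norm_integral_le_of_norm_le_const (a := 0) (b := 1) (C := M)
    (f := fun θ => deriv K (x + θ * (y - x))) (fun θ _ => hK.abs_deriv_le _)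
  simpa [meanSlope] using this

/-- The fundamental theorem of calculus on the segment from x to y. It turns the difference of two
trajectories into the solution of a linear equation. -/
theorem sub_eq_meanSlope_mul (hK : IsBoundedC2 K M) (x y : ℝ) :
    K y - K x = meanSlope K x y * (y - x) := by
  have h : ∀ θ ∈ uIcc (0 : ℝ) 1, HasDerivAt (fun θ => K (x + θ * (y - x)))
      (deriv K (x + θ * (y - x)) * (y - x)) θ := by
    intro θ _
    have h1 : HasDerivAt (fun θ : ℝ => x + θ * (y - x)) (y - x) θ := by
      simpa using ((hasDerivAt_id θ).mul_const (y - x)).const_add x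
    exact (hK.hasDerivAt _).comp θ h1
  have := intervalIntegral.integral_eq_sub_of_hasDerivAt h
    (Continuous.intervalIntegrable ((hK.continuous_deriv.comp (by fun_prop)).mul
      continuous_const) _ _)
  rw [intervalIntegral.integral_mul_const] at this
  simp only [one_mul, zero_mul, add_zero, add_sub_cancel] at this
  rw [meanSlope, this]

end MeanSlope

/-- `X` is a global solution of `X' = u(t) + K(X)`. -/
def IsTrajectory (K u X : ℝ → ℝ) : Prop := ∀ t, HasDerivAt X (u t + K (X t)) t

theorem IsTrajectory.continuous {K u X : ℝ → ℝ} (h : IsTrajectory K u X) : Continuous X :=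
  continuous_iff_continuousAt.2 fun t => (h t).continuousAt

theorem integral_exp_mul_abs_le {l : ℝ} (hl : 0 < l) (t : ℝ) :
    |∫ r in (0 : ℝ)..t, Real.exp (l * |r|)| ≤ Real.exp (l * |t|) / l := by
  have key : ∀ t : ℝ, 0 ≤ t →
      |∫ r in (0 : ℝ)..t, Real.exp (l * |r|)| ≤ Real.exp (l * |t|) / l := by
    intro t ht
    have h1 : ∫ r in (0 : ℝ)..t, Real.exp (l * |r|) = Real.exp (l * t) / l - 1 / l := by
      have : ∀ r ∈ uIcc (0 : ℝ) t,
          HasDerivAt (fun r => Real.exp (l * r) / l) (Real.exp (l * |r|)) r := by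
        intro r hr
        rw [uIcc_of_le ht] at hr
        rw [abs_of_nonneg hr.1]
        exact ((((hasDerivAt_id r).const_mul l).exp).div_const l).congr_deriv
          (by simp; field_simp)
      rw [intervalIntegral.integral_eq_sub_of_hasDerivAt this
        (Continuous.intervalIntegrable (by fun_prop) _ _)]
      simp
    have h2 : 0 ≤ ∫ r in (0 : ℝ)..t, Real.exp (l * |r|) :=
      intervalIntegral.integral_nonneg ht fun _ _ => (Real.exp_pos _).le
    rw [abs_of_nonneg h2, h1, abs_of_nonneg ht]
    have : 0 < 1 / l := by positivity
    linarith
  rcases le_total 0 t with ht | ht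
  · exact key t ht
  · have := key (-t) (by linarith)
    have h := intervalIntegral.integral_comp_neg (a := t) (b := 0)
      (fun r => Real.exp (l * |r|))
    simp only [abs_neg, neg_zero] at h this
    rw [intervalIntegral.integral_symm, abs_neg, h]
    exact this

/-- `K` is globally Lipschitz, so Picard's map contracts globally in a weighted norm. No bound on u
is available; the factor 1 + |J| in the weight absorbs the first Picard increment. -/
theorem exists_trajectory_zero {K u : ℝ → ℝ} {M : ℝ} (hK : IsBoundedC2 K M) (hu : Continuous u)
    (x : ℝ) : ∃ X, X 0 = x ∧ IsTrajectory K u X := by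
  -- This choice gives M / l ≤ 1/2, the contraction factor, and keeps l positive when M = 0.
  set l : ℝ := 2 * M + 1 with hl
  have hl0 : 0 < l := by have := hK.nonneg; positivity
  set J : ℝ → ℝ := fun t => ∫ r in (0 : ℝ)..t, |u r + K x| with hJ
  have hhc : Continuous fun r => |u r + K x| := by fun_prop
  have hJc : Continuous J := intervalIntegral.continuous_primitive (fun _ _ =>
    hhc.intervalIntegrable _ _) 0
  have hJmono : ∀ t, ∀ r ∈ uIoc (0 : ℝ) t, |J r| ≤ |J t| := by
    intro t r hr
    refine intervalIntegral.abs_integral_mono_interval ?_ ?_ (hhc.intervalIntegrable _ _)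
    · exact uIoc_subset_uIoc_of_uIcc_subset_uIcc (uIcc_subset_uIcc left_mem_uIcc
        (uIoc_subset_uIcc hr))
    · exact Eventually.of_forall fun _ => abs_nonneg _
  set w : ℝ → ℝ := fun t => Real.exp (l * |t|) * (1 + |J t|) with hw
  have hwc : Continuous w := by fun_prop
  have hw0 : ∀ t, 0 < w t := fun t => by positivity
  -- Since |J| grows away from 0, the factor 1 + |J r| is bounded by its value at the end point t,
  -- and only the exponential remains to be integrated.
  have hwint : ∀ t, |∫ r in (0 : ℝ)..t, w r| ≤ w t / l := by
    intro t
    have hii : IntervalIntegrable (fun r => Real.exp (l * |r|) * (1 + |J t|))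
        MeasureTheory.volume 0 t := Continuous.intervalIntegrable (by fun_prop) _ _
    have h1 : |∫ r in (0 : ℝ)..t, w r| ≤
        |∫ r in (0 : ℝ)..t, Real.exp (l * |r|) * (1 + |J t|)| := by
      refine intervalIntegral.norm_integral_le_abs_of_norm_le (f := w) ?_ hii
      refine (MeasureTheory.ae_restrict_iff' measurableSet_uIoc).2
        (Eventually.of_forall fun r hr => ?_)
      rw [Real.norm_of_nonneg (hw0 r).le]
      have := hJmono t r hr
      simp only [hw]
      gcongr
    refine h1.trans ?_
    rw [intervalIntegral.integral_mul_const, abs_mul, abs_of_pos (by positivity : 0 < 1 + |J t|)]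
    calc _ ≤ Real.exp (l * |t|) / l * (1 + |J t|) := by
          gcongr
          exact integral_exp_mul_abs_le hl0 t
      _ = w t / l := by simp only [hw]; ring
  set F : (ℝ → ℝ) → ℝ → ℝ := fun X t => x + ∫ r in (0 : ℝ)..t, (u r + K (X r)) with hF
  have hcont : ∀ X : ℝ → ℝ, Continuous X → Continuous fun r => u r + K (X r) := fun X hX =>
    hu.add (hK.continuous.comp hX)
  have hFder : ∀ X : ℝ → ℝ, Continuous X → ∀ t, HasDerivAt (F X) (u t + K (X t)) t := by
    intro X hX t
    exact (intervalIntegral.integral_hasDerivAt_right ((hcont X hX).intervalIntegrable _ _)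
      ((hcont X hX).stronglyMeasurableAtFilter _ _) (hcont X hX).continuousAt).const_add x
  suffices hfix : ∃ X ∈ {X | Continuous X}, F X = X by
    obtain ⟨X, hXc, hX⟩ := hfix
    refine ⟨X, ?_, fun t => ?_⟩
    · rw [← hX]; simp [hF]
    · have := hFder X hXc t
      rwa [hX] at this
  refine exists_fixedPoint_of_weighted_contraction (S := {X | Continuous X})
    (F := F) (u₀ := fun _ => x) (C := 1) hwc hw0 (fun _ h => h) (fun _ _ _ h _ => h)
    (fun X hX => continuous_iff_continuousAt.2 fun t => (hFder X hX t).continuousAt)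
    continuous_const ?_ ?_
  · intro t
    have h1 : |F (fun _ => x) t - x| ≤ |J t| := by
      simp only [hF, add_sub_cancel_left]
      exact intervalIntegral.norm_integral_le_abs_of_norm_le (f := fun r => u r + K x)
        (g := fun r => |u r + K x|) (Eventually.of_forall fun r => le_rfl) (hhc.intervalIntegrable _ _)
    have h2 : 1 ≤ Real.exp (l * |t|) := Real.one_le_exp (by positivity)
    have h3 := abs_nonneg (J t)
    simp only [hw]
    nlinarith
  · intro X hX Y hY s hs hXY t
    have h1 : F X t - F Y t = ∫ r in (0 : ℝ)..t, (K (X r) - K (Y r)) := by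
      simp only [hF, add_sub_add_left_eq_sub]
      rw [← intervalIntegral.integral_sub ((hcont X hX).intervalIntegrable _ _)
        ((hcont Y hY).intervalIntegrable _ _)]
      simp
    have h2 : |F X t - F Y t| ≤ |∫ r in (0 : ℝ)..t, M * s * w r| := by
      rw [h1]
      refine intervalIntegral.norm_integral_le_abs_of_norm_le (f := fun r => K (X r) - K (Y r))
        (g := fun r => M * s * w r) (Eventually.of_forall fun r => ?_)
        (Continuous.intervalIntegrable (by fun_prop) _ _)
      rw [mul_assoc]
      exact (hK.lipschitz _ _).trans (mul_le_mul_of_nonneg_left (hXY r) hK.nonneg)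
    refine h2.trans ?_
    rw [intervalIntegral.integral_const_mul, abs_mul,
      abs_of_nonneg (mul_nonneg hK.nonneg hs.le)]
    calc M * s * |∫ r in (0 : ℝ)..t, w r| ≤ M * s * (w t / l) :=
          mul_le_mul_of_nonneg_left (hwint t) (mul_nonneg hK.nonneg hs.le)
      _ = (M / l) * (s * w t) := by ring
      _ ≤ (1 / 2) * (s * w t) := by
          refine mul_le_mul_of_nonneg_right ?_ (mul_pos hs (hw0 t)).le
          rw [div_le_div_iff₀ hl0 (by norm_num)]
          linarith
      _ = s / 2 * w t := by ring

theorem exists_trajectory {K u : ℝ → ℝ} {M : ℝ} (hK : IsBoundedC2 K M) (hu : Continuous u)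
    (s x : ℝ) : ∃ X, X s = x ∧ IsTrajectory K u X := by
  obtain ⟨Y, hY0, hY⟩ := exists_trajectory_zero hK (u := fun t => u (t + s)) (by fun_prop) x
  refine ⟨fun t => Y (t - s), by simpa using hY0, fun t => ?_⟩
  have := (hY (t - s)).comp_sub_const t s
  simpa using this

theorem IsTrajectory.eq {K u X Y : ℝ → ℝ} {M : ℝ} (hK : IsBoundedC2 K M)
    (hX : IsTrajectory K u X) (hY : IsTrajectory K u Y) {s : ℝ} (h : X s = Y s) : X = Y :=
  ODE_solution_unique_univ (v := fun t x => u t + K x) (s := fun _ => univ) (t₀ := s)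
    (fun t => (hK.lipschitzWith (u t)).lipschitzOnWith) (fun t => ⟨hX t, trivial⟩)
    (fun t => ⟨hY t, trivial⟩) h

/-- The trajectory of `X' = u(t) + K(X)` with `X s = x`. -/
noncomputable def trajectory (K u : ℝ → ℝ) (s x : ℝ) : ℝ → ℝ :=
  Classical.epsilon fun X => X s = x ∧ IsTrajectory K u X

/-! ### The flow of the characteristic ODE, its inverse and its spatial derivative -/

section Flow

variable {K u : ℝ → ℝ} {M : ℝ}

theorem trajectory_self (hK : IsBoundedC2 K M) (hu : Continuous u) (s x : ℝ) :
    trajectory K u s x s = x :=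
  (Classical.epsilon_spec (exists_trajectory hK hu s x)).1

theorem isTrajectory_trajectory (hK : IsBoundedC2 K M) (hu : Continuous u) (s x : ℝ) :
    IsTrajectory K u (trajectory K u s x) :=
  (Classical.epsilon_spec (exists_trajectory hK hu s x)).2

/-- The flow of `X' = u(t) + K(X)` from time `0` to time `t`. -/
noncomputable def flow (K u : ℝ → ℝ) (t x : ℝ) : ℝ := trajectory K u 0 x t

/-- The inverse of `flow K u t`. -/
noncomputable def invFlow (K u : ℝ → ℝ) (t x : ℝ) : ℝ := trajectory K u t x 0

/-- The spatial derivative of the flow. -/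
noncomputable def flowDeriv (K u : ℝ → ℝ) (t x : ℝ) : ℝ :=
  Real.exp (∫ r in (0 : ℝ)..t, deriv K (flow K u r x))

theorem flow_zero (hK : IsBoundedC2 K M) (hu : Continuous u) (x : ℝ) : flow K u 0 x = x :=
  trajectory_self hK hu 0 x

theorem isTrajectory_flow (hK : IsBoundedC2 K M) (hu : Continuous u) (x : ℝ) :
    IsTrajectory K u (fun t => flow K u t x) :=
  isTrajectory_trajectory hK hu 0 x

theorem invFlow_zero (hK : IsBoundedC2 K M) (hu : Continuous u) (x : ℝ) : invFlow K u 0 x = x :=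
  trajectory_self hK hu 0 x

theorem flow_invFlow (hK : IsBoundedC2 K M) (hu : Continuous u) (t x : ℝ) :
    flow K u t (invFlow K u t x) = x := by
  have h := IsTrajectory.eq hK (isTrajectory_trajectory hK hu 0 (invFlow K u t x))
    (isTrajectory_trajectory hK hu t x) (s := 0) (trajectory_self hK hu _ _)
  rw [flow, h, trajectory_self hK hu]

theorem invFlow_flow (hK : IsBoundedC2 K M) (hu : Continuous u) (t x : ℝ) :
    invFlow K u t (flow K u t x) = x := by
  have h := IsTrajectory.eq hK (isTrajectory_trajectory hK hu t (flow K u t x))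
    (isTrajectory_trajectory hK hu 0 x) (s := t) (trajectory_self hK hu _ _)
  rw [invFlow, h, trajectory_self hK hu]

/-- The difference of two trajectories solves D' = a D with a the mean slope of `K` between them.
The exact formula yields both the Lipschitz bound and the spatial derivative of the flow. -/
theorem flow_sub_flow (hK : IsBoundedC2 K M) (hu : Continuous u) (t x y : ℝ) :
    flow K u t y - flow K u t x =
      (y - x) * Real.exp (∫ r in (0 : ℝ)..t, meanSlope K (flow K u r x) (flow K u r y)) := by
  have hx := isTrajectory_flow hK hu x
  have hy := isTrajectory_flow hK hu y
  have := eq_mul_exp_integral_of_hasDerivAt (D := fun t => flow K u t y - flow K u t x)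
    (a := fun r => meanSlope K (flow K u r x) (flow K u r y))
    ((continuous_meanSlope hK).comp (hx.continuous.prodMk hy.continuous))
    (fun r => ((hy r).fun_sub (hx r)).congr_deriv
      (by rw [← sub_eq_meanSlope_mul hK]; ring)) 0 t
  simpa only [flow_zero hK hu] using this

theorem abs_flow_sub_flow_le (hK : IsBoundedC2 K M) (hu : Continuous u) (t x y : ℝ) :
    |flow K u t y - flow K u t x| ≤ |y - x| * Real.exp (M * |t|) := by
  rw [flow_sub_flow hK hu, abs_mul, Real.abs_exp]
  gcongr
  refine (le_abs_self _).trans ?_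
  simpa using intervalIntegral.norm_integral_le_of_norm_le_const (a := 0) (b := t) (C := M)
    (f := fun r => meanSlope K (flow K u r x) (flow K u r y)) (fun θ _ => abs_meanSlope_le hK _ _)

theorem continuous_flow (hK : IsBoundedC2 K M) (hu : Continuous u) :
    Continuous fun p : ℝ × ℝ => flow K u p.1 p.2 := by
  rw [continuous_iff_continuousAt]
  rintro ⟨t, x⟩
  have h1 : Tendsto (fun p : ℝ × ℝ => |p.2 - x| * Real.exp (M * |p.1|) +
      |flow K u p.1 x - flow K u t x|) (𝓝 (t, x)) (𝓝 0) := by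
    have hc : Continuous fun p : ℝ × ℝ => |p.2 - x| * Real.exp (M * |p.1|) +
        |flow K u p.1 x - flow K u t x| := by
      have : Continuous fun p : ℝ × ℝ => flow K u p.1 x :=
        (isTrajectory_flow hK hu x).continuous.comp continuous_fst
      fun_prop
    simpa using hc.tendsto (t, x)
  rw [ContinuousAt, tendsto_iff_dist_tendsto_zero]
  refine squeeze_zero (fun _ => dist_nonneg) (fun p => ?_) h1
  rw [Real.dist_eq]
  calc _ = |(flow K u p.1 p.2 - flow K u p.1 x) + (flow K u p.1 x - flow K u t x)| := by
        congr 1; ring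
    _ ≤ _ := (abs_add_le _ _).trans (add_le_add_left (abs_flow_sub_flow_le hK hu _ _ _) _)

theorem continuous_flowDeriv (hK : IsBoundedC2 K M) (hu : Continuous u) :
    Continuous fun p : ℝ × ℝ => flowDeriv K u p.1 p.2 := by
  refine Real.continuous_exp.comp ?_
  refine intervalIntegral.continuous_parametric_intervalIntegral_of_continuous
    (f := fun (p : ℝ × ℝ) r => deriv K (flow K u r p.2)) ?_ continuous_fst
  exact hK.continuous_deriv.comp ((continuous_flow hK hu).comp
    (continuous_snd.prodMk (continuous_snd.comp continuous_fst)))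

theorem flowDeriv_pos (K u : ℝ → ℝ) (t x : ℝ) : 0 < flowDeriv K u t x := Real.exp_pos _

theorem flowDeriv_zero (K u : ℝ → ℝ) (x : ℝ) : flowDeriv K u 0 x = 1 := by simp [flowDeriv]

theorem hasDerivAt_flow_left (hK : IsBoundedC2 K M) (hu : Continuous u) (t x : ℝ) :
    HasDerivAt (fun s => flow K u s x) (u t + K (flow K u t x)) t :=
  isTrajectory_flow hK hu x t

/-- The factor of y - x in `flow_sub_flow` is continuous in y, and at y = x the mean slope becomes
K' along the trajectory. -/
theorem hasDerivAt_flow_right (hK : IsBoundedC2 K M) (hu : Continuous u) (t x : ℝ) :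
    HasDerivAt (flow K u t) (flowDeriv K u t x) x := by
  have hE : Continuous fun y =>
      Real.exp (∫ r in (0 : ℝ)..t, meanSlope K (flow K u r x) (flow K u r y)) := by
    refine Real.continuous_exp.comp ?_
    refine intervalIntegral.continuous_parametric_intervalIntegral_of_continuous'
      (f := fun y r => meanSlope K (flow K u r x) (flow K u r y)) ?_ 0 t
    have h1 := (continuous_flow hK hu).comp
      (continuous_snd.prodMk continuous_const : Continuous fun p : ℝ × ℝ => (p.2, x))
    have h2 := (continuous_flow hK hu).comp
      (continuous_snd.prodMk continuous_fst : Continuous fun p : ℝ × ℝ => (p.2, p.1))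
    exact (continuous_meanSlope hK).comp (h1.prodMk h2)
  have := HasDerivAt.of_eq_add_sub_mul (f := flow K u t) (x := x)
    (fun y => by rw [← flow_sub_flow hK hu]; ring) hE.continuousAt
  simpa only [meanSlope_self, flowDeriv] using this

theorem hasStrictFDerivAt_flow (hK : IsBoundedC2 K M) (hu : Continuous u) (p : ℝ × ℝ) :
    HasStrictFDerivAt (fun p : ℝ × ℝ => flow K u p.1 p.2)
      ((ContinuousLinearMap.toSpanSingleton ℝ (u p.1 + K (flow K u p.1 p.2))).coprod
        (ContinuousLinearMap.toSpanSingleton ℝ (flowDeriv K u p.1 p.2))) p :=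
  hasStrictFDerivAt_of_continuous_partials (hasDerivAt_flow_left hK hu)
    (hasDerivAt_flow_right hK hu)
    ((hu.comp continuous_fst).add (hK.continuous.comp (continuous_flow hK hu)))
    (continuous_flowDeriv hK hu) p

theorem contDiff_flow (hK : IsBoundedC2 K M) (hu : Continuous u) :
    ContDiff ℝ 1 fun p : ℝ × ℝ => flow K u p.1 p.2 :=
  contDiff_one_of_continuous_partials (hasDerivAt_flow_left hK hu)
    (hasDerivAt_flow_right hK hu)
    ((hu.comp continuous_fst).add (hK.continuous.comp (continuous_flow hK hu)))
    (continuous_flowDeriv hK hu)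

end Flow

/-! ### Smoothness of the flow, of its spatial derivative and of its inverse -/

theorem hasDerivAt_integral_of_continuous_deriv {g g' : ℝ → ℝ → ℝ}
    (hg : ∀ x, Continuous (g x)) (hg' : Continuous fun p : ℝ × ℝ => g' p.1 p.2)
    (hd : ∀ x r, HasDerivAt (fun x => g x r) (g' x r) x) (a b x : ℝ) :
    HasDerivAt (fun x => ∫ r in a..b, g x r) (∫ r in a..b, g' x r) x := by
  set E : ℝ → ℝ → ℝ := fun y r => ∫ θ in (0 : ℝ)..1, g' (x + θ * (y - x)) r with hE
  have hEc : Continuous fun p : ℝ × ℝ => E p.1 p.2 := by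
    refine intervalIntegral.continuous_parametric_intervalIntegral_of_continuous'
      (f := fun (p : ℝ × ℝ) θ => g' (x + θ * (p.1 - x)) p.2) ?_ 0 1
    exact hg'.comp (by fun_prop :
      Continuous fun q : (ℝ × ℝ) × ℝ => (x + q.2 * (q.1.1 - x), q.1.2))
  have hmean : ∀ y r, g y r - g x r = (y - x) * E y r := by
    intro y r
    have h : ∀ θ ∈ uIcc (0 : ℝ) 1, HasDerivAt (fun θ => g (x + θ * (y - x)) r)
        (g' (x + θ * (y - x)) r * (y - x)) θ := by
      intro θ _
      have h1 : HasDerivAt (fun θ : ℝ => x + θ * (y - x)) (y - x) θ := by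
        simpa using ((hasDerivAt_id θ).mul_const (y - x)).const_add x
      exact (hd _ r).comp θ h1
    have hc : Continuous fun θ => g' (x + θ * (y - x)) r * (y - x) :=
      (hg'.comp (by fun_prop : Continuous fun θ => (x + θ * (y - x), r))).mul continuous_const
    have := intervalIntegral.integral_eq_sub_of_hasDerivAt h (hc.intervalIntegrable _ _)
    rw [intervalIntegral.integral_mul_const] at this
    simp only [one_mul, zero_mul, add_zero, add_sub_cancel] at this
    rw [hE, ← this]
    ring
  have hcont : Continuous fun y => ∫ r in a..b, E y r :=
    intervalIntegral.continuous_parametric_intervalIntegral_of_continuous' hEc a b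
  have hEx : ∀ r, E x r = g' x r := fun r => by simp [hE]
  have := HasDerivAt.of_eq_add_sub_mul (f := fun x => ∫ r in a..b, g x r) (x := x)
    (E := fun y => ∫ r in a..b, E y r) (fun y => ?_) hcont.continuousAt
  · simpa only [hEx] using this
  · rw [← intervalIntegral.integral_const_mul, ← intervalIntegral.integral_add
      ((hg x).intervalIntegrable _ _)
      (Continuous.intervalIntegrable (by fun_prop) _ _)]
    refine intervalIntegral.integral_congr fun r _ => ?_
    simp only [← hmean]
    ring

section Flow

variable {K u : ℝ → ℝ} {M : ℝ}

/-- The partial derivatives of the exponent are K'(flow) in time and ∫ K''(flow) · `flowDeriv` in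
space. No derivative of u enters, so continuity of u suffices. -/
theorem contDiff_flowDeriv (hK : IsBoundedC2 K M) (hu : Continuous u) :
    ContDiff ℝ 1 fun p : ℝ × ℝ => flowDeriv K u p.1 p.2 := by
  have hφ := continuous_flow hK hu
  have hc₁ : Continuous fun p : ℝ × ℝ => deriv K (flow K u p.1 p.2) :=
    hK.continuous_deriv.comp hφ
  have hc₂ : Continuous fun p : ℝ × ℝ =>
      deriv (deriv K) (flow K u p.2 p.1) * flowDeriv K u p.2 p.1 :=
    ((hK.continuous_deriv_deriv.comp hφ).mul (continuous_flowDeriv hK hu)).comp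
      (continuous_snd.prodMk continuous_fst)
  refine ContDiff.exp (contDiff_one_of_continuous_partials
    (f := fun t x => ∫ r in (0 : ℝ)..t, deriv K (flow K u r x))
    (f₁ := fun t x => deriv K (flow K u t x))
    (f₂ := fun t x => ∫ r in (0 : ℝ)..t,
      deriv (deriv K) (flow K u r x) * flowDeriv K u r x) ?_ ?_ hc₁ ?_)
  · intro t x
    have h : Continuous fun r => deriv K (flow K u r x) :=
      hc₁.comp (continuous_id.prodMk continuous_const)
    exact intervalIntegral.integral_hasDerivAt_right (h.intervalIntegrable _ _)
      (h.stronglyMeasurableAtFilter _ _) h.continuousAt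
  · intro t x
    exact hasDerivAt_integral_of_continuous_deriv (g := fun x r => deriv K (flow K u r x))
      (g' := fun x r => deriv (deriv K) (flow K u r x) * flowDeriv K u r x)
      (fun x => hc₁.comp (continuous_id.prodMk continuous_const)) hc₂
      (fun x r => (hK.hasDerivAt_deriv _).comp x (hasDerivAt_flow_right hK hu r x)) 0 t x
  · exact intervalIntegral.continuous_parametric_intervalIntegral_of_continuous
      (f := fun (p : ℝ × ℝ) r => deriv (deriv K) (flow K u r p.2) * flowDeriv K u r p.2)
      (hc₂.comp ((continuous_snd.comp continuous_fst).prodMk continuous_snd)) continuous_fst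

theorem hasDerivAt_flowDeriv_left (hK : IsBoundedC2 K M) (hu : Continuous u) (t x : ℝ) :
    HasDerivAt (fun s => flowDeriv K u s x)
      (flowDeriv K u t x * deriv K (flow K u t x)) t := by
  have h : Continuous fun r => deriv K (flow K u r x) :=
    hK.continuous_deriv.comp (isTrajectory_flow hK hu x).continuous
  exact (intervalIntegral.integral_hasDerivAt_right (h.intervalIntegrable _ _)
      (h.stronglyMeasurableAtFilter _ _) h.continuousAt).exp

/-- Inverse function theorem for (t, x) ↦ (t, flow), whose derivative is triangular with diagonal
entries 1 and `flowDeriv` > 0. The map is a bijection with explicit inverse, and open, hence a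
homeomorphism with C¹ inverse. -/
theorem contDiff_invFlow (hK : IsBoundedC2 K M) (hu : Continuous u) :
    ContDiff ℝ 1 fun p : ℝ × ℝ => invFlow K u p.1 p.2 := by
  set Θ : ℝ × ℝ → ℝ × ℝ := fun p => (p.1, flow K u p.1 p.2) with hΘ
  let e : ℝ × ℝ ≃ ℝ × ℝ :=
    { toFun := Θ
      invFun := fun p => (p.1, invFlow K u p.1 p.2)
      left_inv := fun p => by simp [hΘ, invFlow_flow hK hu]
      right_inv := fun p => by simp [hΘ, flow_invFlow hK hu] }
  have hinv : ∀ (a b : ℝ), b ≠ 0 → ∃ f : (ℝ × ℝ) ≃L[ℝ] (ℝ × ℝ),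
      (f : ℝ × ℝ →L[ℝ] ℝ × ℝ) = (ContinuousLinearMap.fst ℝ ℝ ℝ).prod
        ((ContinuousLinearMap.toSpanSingleton ℝ a).coprod
          (ContinuousLinearMap.toSpanSingleton ℝ b)) := by
    intro a b hb
    refine ⟨ContinuousLinearEquiv.equivOfInverse ((ContinuousLinearMap.fst ℝ ℝ ℝ).prod
        ((ContinuousLinearMap.toSpanSingleton ℝ a).coprod
          (ContinuousLinearMap.toSpanSingleton ℝ b)))
        ((ContinuousLinearMap.fst ℝ ℝ ℝ).prod
        ((ContinuousLinearMap.toSpanSingleton ℝ (-a / b)).coprod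
          (ContinuousLinearMap.toSpanSingleton ℝ (1 / b)))) ?_ ?_, ?_⟩
    · intro p
      ext
      · simp
      · simp
        field_simp
        ring
    · intro p
      ext
      · simp
      · simp
        field_simp
        ring
    · ext <;> simp
  have hder : ∀ p : ℝ × ℝ, ∃ f : (ℝ × ℝ) ≃L[ℝ] (ℝ × ℝ),
      HasStrictFDerivAt Θ (f : ℝ × ℝ →L[ℝ] ℝ × ℝ) p := by
    intro p
    obtain ⟨f, hf⟩ := hinv (u p.1 + K (flow K u p.1 p.2)) (flowDeriv K u p.1 p.2)
      (flowDeriv_pos K u _ _).ne'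
    refine ⟨f, ?_⟩
    rw [hf]
    exact hasStrictFDerivAt_fst.prodMk (hasStrictFDerivAt_flow hK hu p)
  choose f hf using hder
  have hΘc : ContDiff ℝ 1 Θ := contDiff_fst.prodMk (contDiff_flow hK hu)
  let h : ℝ × ℝ ≃ₜ ℝ × ℝ := e.toHomeomorphOfContinuousOpen hΘc.continuous
    (isOpenMap_of_hasStrictFDerivAt_equiv hf)
  have := h.contDiff_symm (f₀' := f) (fun p => (hf p).hasFDerivAt) hΘc
  exact contDiff_snd.comp this

/-- Obtained by differentiating the identity flow_s(invFlow_s x) = x in s. -/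
theorem hasDerivAt_invFlow_left (hK : IsBoundedC2 K M) (hu : Continuous u) (t x : ℝ) :
    HasDerivAt (fun s => invFlow K u s x)
      (-(u t + K x) / flowDeriv K u t (invFlow K u t x)) t := by
  have hd : DifferentiableAt ℝ (fun s => invFlow K u s x) t :=
    (((contDiff_invFlow hK hu).comp (contDiff_id.prodMk contDiff_const)).differentiable
      (by norm_num)) t
  obtain ⟨ρ', hρ⟩ : ∃ ρ', HasDerivAt (fun s => invFlow K u s x) ρ' t := ⟨_, hd.hasDerivAt⟩
  have h1 := (hasStrictFDerivAt_flow hK hu (t, invFlow K u t x)).hasFDerivAt.comp_hasDerivAt t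
    ((hasDerivAt_id t).prodMk hρ)
  have h2 : HasDerivAt (fun _ : ℝ => x) 0 t := hasDerivAt_const t x
  have h3 := h1.unique (h2.congr_of_eventuallyEq
    (Eventually.of_forall fun s => flow_invFlow hK hu s x))
  simp [flow_invFlow hK hu] at h3
  have h4 := flowDeriv_pos K u t (invFlow K u t x)
  refine hρ.congr_deriv ?_
  rw [eq_div_iff h4.ne']
  linarith

end Flow

/-! ### The solution generated by an inflow `u` and an initial profile `q` -/

/-- The retraction of `ℝ` onto `[0, 1]`. -/
noncomputable def clamp01 (y : ℝ) : ℝ := max 0 (min 1 y)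

theorem clamp01_mem (y : ℝ) : clamp01 y ∈ Icc (0 : ℝ) 1 :=
  ⟨le_max_left _ _, max_le zero_le_one (min_le_left _ _)⟩

theorem continuous_clamp01 : Continuous clamp01 := by unfold clamp01; fun_prop

theorem clamp01_of_mem {y : ℝ} (hy : y ∈ Icc (0 : ℝ) 1) : clamp01 y = y := by
  rw [clamp01, min_eq_right hy.2, max_eq_right hy.1]

theorem clamp01_of_nonpos {y : ℝ} (hy : y ≤ 0) : clamp01 y = 0 :=
  max_eq_left ((min_le_right _ _).trans hy)

/-- The time at which the characteristic `η - τ = y` enters the strip `τ ≥ 0`, `η ∈ [0, 1]`. -/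
noncomputable def entryTime (y : ℝ) : ℝ := max (-y) 0

theorem entryTime_nonneg (y : ℝ) : 0 ≤ entryTime y := le_max_right _ _

theorem entryTime_of_nonneg {y : ℝ} (hy : 0 ≤ y) : entryTime y = 0 := max_eq_right (by linarith)

theorem entryTime_of_nonpos {y : ℝ} (hy : y ≤ 0) : entryTime y = -y := max_eq_left (by linarith)

theorem continuous_entryTime : Continuous entryTime := by unfold entryTime; fun_prop

/-- The value at time `0` of the trajectory carried by the characteristic `η - τ = y`. -/
noncomputable def label (K u q : ℝ → ℝ) (y : ℝ) : ℝ := invFlow K u (entryTime y) (q (clamp01 y))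

/-- The spatial derivative of the solution where the characteristic `η - τ = y` enters the strip. -/
noncomputable def entrySlope (u q : ℝ → ℝ) (y : ℝ) : ℝ :=
  dEta q (clamp01 y) + (u (entryTime y) - u 0)

/-- The derivative of `label`. -/
noncomputable def labelDeriv (K u q : ℝ → ℝ) (y : ℝ) : ℝ :=
  entrySlope u q y / flowDeriv K u (entryTime y) (label K u q y)

/-- The solution of `∂_τ Q + ∂_η Q = u + K(Q)` with initial value `q` and boundary value `0`. -/
noncomputable def profile (K u q : ℝ → ℝ) (τ η : ℝ) : ℝ := flow K u τ (label K u q (η - τ))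

/-- The spatial derivative of `profile`. -/
noncomputable def profileDeriv (K u q : ℝ → ℝ) (τ η : ℝ) : ℝ :=
  flowDeriv K u τ (label K u q (η - τ)) * labelDeriv K u q (η - τ)

theorem entrySlope_of_nonneg (u q : ℝ → ℝ) {y : ℝ} (hy : 0 ≤ y) :
    entrySlope u q y = dEta q (clamp01 y) := by
  simp [entrySlope, entryTime_of_nonneg hy]

theorem entrySlope_of_nonpos {K u q : ℝ → ℝ} (hc : u 0 + K 0 = dEta q 0) {y : ℝ} (hy : y ≤ 0) :
    entrySlope u q y = u (-y) + K 0 := by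
  rw [entrySlope, entryTime_of_nonpos hy, clamp01_of_nonpos hy, ← hc]
  ring

theorem continuousOn_dEta {q : ℝ → ℝ} (hq : ContDiffOn ℝ 1 q (Icc 0 1)) :
    ContinuousOn (dEta q) (Icc 0 1) :=
  hq.continuousOn_derivWithin (uniqueDiffOn_Icc zero_lt_one) le_rfl

theorem hasDerivWithinAt_dEta {q : ℝ → ℝ} (hq : ContDiffOn ℝ 1 q (Icc 0 1)) {y : ℝ}
    (hy : y ∈ Icc (0 : ℝ) 1) : HasDerivWithinAt q (dEta q y) (Icc 0 1) y :=
  (hq.differentiableOn (by norm_num) y hy).hasDerivWithinAt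

theorem contDiffOn_succ_of_partials {f A B : ℝ × ℝ → ℝ} {s : Set (ℝ × ℝ)} {n : ℕ}
    (hs : UniqueDiffOn ℝ s)
    (hf : ∀ p ∈ s, HasFDerivWithinAt f (A p • ContinuousLinearMap.fst ℝ ℝ ℝ +
      B p • ContinuousLinearMap.snd ℝ ℝ ℝ) s p)
    (hA : ContDiffOn ℝ n A s) (hB : ContDiffOn ℝ n B s) : ContDiffOn ℝ (n + 1) f s := by
  rw [contDiffOn_succ_iff_hasFDerivWithinAt_of_uniqueDiffOn hs]
  refine ⟨by simp, _, ?_, hf⟩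
  exact (hA.smul contDiffOn_const).add (hB.smul contDiffOn_const)

theorem hasDerivWithinAt_Iic_of_pieces {f : ℝ → ℝ} {f' y : ℝ}
    (h0 : y ≤ 0 → HasDerivWithinAt f f' (Iic 0) y)
    (h1 : y ∈ Icc (0 : ℝ) 1 → HasDerivWithinAt f f' (Icc 0 1) y) (hy : y ≤ 1) :
    HasDerivWithinAt f f' (Iic 1) y := by
  rw [← Iic_union_Icc_eq_Iic (zero_le_one' ℝ)]
  refine HasDerivWithinAt.union ?_ ?_
  · by_cases h : y ≤ 0
    · exact h0 h
    · exact HasFDerivWithinAt.of_notMem_closure (by simpa using h)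
  · by_cases h : 0 ≤ y
    · exact h1 ⟨h, hy⟩
    · exact HasFDerivWithinAt.of_notMem_closure (by simp [h])

section Profile

variable {K u q : ℝ → ℝ} {M : ℝ}

theorem continuous_comp_clamp01 (hq : ContDiffOn ℝ 1 q (Icc 0 1)) :
    Continuous fun y => q (clamp01 y) :=
  hq.continuousOn.comp_continuous continuous_clamp01 clamp01_mem

theorem continuous_entrySlope (hu : Continuous u) (hq : ContDiffOn ℝ 1 q (Icc 0 1)) :
    Continuous (entrySlope u q) :=
  ((continuousOn_dEta hq).comp_continuous continuous_clamp01 clamp01_mem).add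
    ((hu.comp continuous_entryTime).sub continuous_const)

theorem continuous_label (hK : IsBoundedC2 K M) (hu : Continuous u)
    (hq : ContDiffOn ℝ 1 q (Icc 0 1)) : Continuous (label K u q) :=
  (contDiff_invFlow hK hu).continuous.comp
    (continuous_entryTime.prodMk (continuous_comp_clamp01 hq))

theorem continuous_labelDeriv (hK : IsBoundedC2 K M) (hu : Continuous u)
    (hq : ContDiffOn ℝ 1 q (Icc 0 1)) : Continuous (labelDeriv K u q) :=
  (continuous_entrySlope hu hq).div
    ((continuous_flowDeriv hK hu).comp (continuous_entryTime.prodMk (continuous_label hK hu hq)))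
    fun _ => (flowDeriv_pos K u _ _).ne'

theorem continuous_profile (hK : IsBoundedC2 K M) (hu : Continuous u)
    (hq : ContDiffOn ℝ 1 q (Icc 0 1)) : Continuous fun p : ℝ × ℝ => profile K u q p.1 p.2 :=
  (continuous_flow hK hu).comp (continuous_fst.prodMk
    ((continuous_label hK hu hq).comp (continuous_snd.sub continuous_fst)))

theorem continuous_profileDeriv (hK : IsBoundedC2 K M) (hu : Continuous u)
    (hq : ContDiffOn ℝ 1 q (Icc 0 1)) :
    Continuous fun p : ℝ × ℝ => profileDeriv K u q p.1 p.2 :=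
  ((continuous_flowDeriv hK hu).comp (continuous_fst.prodMk
    ((continuous_label hK hu hq).comp (continuous_snd.sub continuous_fst)))).mul
    ((continuous_labelDeriv hK hu hq).comp (continuous_snd.sub continuous_fst))

theorem label_of_mem (hK : IsBoundedC2 K M) (hu : Continuous u) {y : ℝ}
    (hy : y ∈ Icc (0 : ℝ) 1) : label K u q y = q y := by
  rw [label, entryTime_of_nonneg hy.1, clamp01_of_mem hy, invFlow_zero hK hu]

theorem labelDeriv_of_mem {y : ℝ} (hy : y ∈ Icc (0 : ℝ) 1) : labelDeriv K u q y = dEta q y := by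
  rw [labelDeriv, entrySlope_of_nonneg u q hy.1, entryTime_of_nonneg hy.1, clamp01_of_mem hy,
    flowDeriv_zero, div_one]

theorem label_of_nonpos (hq0 : q 0 = 0) {y : ℝ} (hy : y ≤ 0) :
    label K u q y = invFlow K u (-y) 0 := by
  rw [label, entryTime_of_nonpos hy, clamp01_of_nonpos hy, hq0]

/-- For y ≤ 0 the label is the inverse flow at time -y of the boundary value; on [0, 1] it is q. The
hypothesis `hc` is exactly the agreement of the two one-sided slopes at y = 0. -/
theorem hasDerivWithinAt_label (hK : IsBoundedC2 K M) (hu : Continuous u)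
    (hq : ContDiffOn ℝ 1 q (Icc 0 1)) (hq0 : q 0 = 0) (hc : u 0 + K 0 = dEta q 0)
    {y : ℝ} (hy : y ≤ 1) : HasDerivWithinAt (label K u q) (labelDeriv K u q y) (Iic 1) y := by
  refine hasDerivWithinAt_Iic_of_pieces (fun h => ?_) (fun h => ?_) hy
  · have h1 := (hasDerivAt_invFlow_left hK hu (-y) 0).scomp y (hasDerivAt_neg y)
    refine (h1.hasDerivWithinAt.congr (fun z hz => label_of_nonpos hq0 hz)
      (label_of_nonpos hq0 h)).congr_deriv ?_
    rw [labelDeriv, entrySlope_of_nonpos hc h, label_of_nonpos hq0 h, entryTime_of_nonpos h]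
    simp only [smul_eq_mul]
    ring
  · rw [labelDeriv_of_mem h]
    exact (hasDerivWithinAt_dEta hq h).congr (fun z hz => label_of_mem hK hu hz)
      (label_of_mem hK hu h)

/-- Chain rule for flow(τ, label(η - τ)). That the τ-coefficient is u + K(Q) minus the η-coefficient
is the transport equation. -/
theorem hasFDerivWithinAt_profile (hK : IsBoundedC2 K M) (hu : Continuous u)
    (hq : ContDiffOn ℝ 1 q (Icc 0 1)) (hq0 : q 0 = 0) (hc : u 0 + K 0 = dEta q 0)
    {s : Set (ℝ × ℝ)} (hs : ∀ p ∈ s, p.2 - p.1 ≤ 1) {p : ℝ × ℝ} (hp : p ∈ s) :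
    HasFDerivWithinAt (fun p : ℝ × ℝ => profile K u q p.1 p.2)
      ((u p.1 + K (profile K u q p.1 p.2) - profileDeriv K u q p.1 p.2) •
        ContinuousLinearMap.fst ℝ ℝ ℝ +
        profileDeriv K u q p.1 p.2 • ContinuousLinearMap.snd ℝ ℝ ℝ) s p := by
  have h1 : HasFDerivWithinAt (fun p : ℝ × ℝ => p.2 - p.1)
      (ContinuousLinearMap.snd ℝ ℝ ℝ - ContinuousLinearMap.fst ℝ ℝ ℝ) s p :=
    (hasFDerivAt_snd.sub hasFDerivAt_fst).hasFDerivWithinAt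
  have h2 := (hasDerivWithinAt_label hK hu hq hq0 hc (hs p hp)).comp_hasFDerivWithinAt p h1
    (fun z hz => hs z hz)
  have h3 := (hasStrictFDerivAt_flow hK hu
    (p.1, label K u q (p.2 - p.1))).hasFDerivAt.comp_hasFDerivWithinAt p
    (hasFDerivAt_fst.hasFDerivWithinAt.prodMk h2)
  refine h3.congr_fderiv ?_
  ext <;> simp [profile, profileDeriv] <;> ring

theorem profile_zero_right (hK : IsBoundedC2 K M) (hu : Continuous u) (hq0 : q 0 = 0)
    {τ : ℝ} (hτ : 0 ≤ τ) : profile K u q τ 0 = 0 := by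
  rw [profile, label_of_nonpos hq0 (by linarith)]
  simp [flow_invFlow hK hu]

theorem profile_zero_left (hK : IsBoundedC2 K M) (hu : Continuous u) {η : ℝ}
    (hη : η ∈ Icc (0 : ℝ) 1) : profile K u q 0 η = q η := by
  rw [profile, sub_zero, label_of_mem hK hu hη, flow_zero hK hu]

theorem flow_entryTime_label (hK : IsBoundedC2 K M) (hu : Continuous u) (y : ℝ) :
    flow K u (entryTime y) (label K u q y) = q (clamp01 y) :=
  flow_invFlow hK hu _ _

/-- The quotient of the two `flowDeriv` factors removes the part of the exponent before entry. In
the strip the remaining time is at most 1 (`sub_entryTime_mem`), which bounds the exponential by exp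
M uniformly in τ. -/
theorem profileDeriv_eq (hK : IsBoundedC2 K M) (hu : Continuous u) (τ η : ℝ) :
    profileDeriv K u q τ η = entrySlope u q (η - τ) *
      Real.exp (∫ r in entryTime (η - τ)..τ, deriv K (flow K u r (label K u q (η - τ)))) := by
  have h : Continuous fun r => deriv K (flow K u r (label K u q (η - τ))) :=
    hK.continuous_deriv.comp (isTrajectory_flow hK hu _).continuous
  have h' := intervalIntegral.integral_interval_sub_left
    (μ := MeasureTheory.volume) (h.intervalIntegrable 0 τ)
    (h.intervalIntegrable 0 (entryTime (η - τ)))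
  rw [profileDeriv, labelDeriv, flowDeriv, flowDeriv, ← h', Real.exp_sub]
  ring

theorem sub_entryTime_mem {τ η : ℝ} (hτ : 0 ≤ τ) (hη : η ∈ Icc (0 : ℝ) 1) :
    entryTime (η - τ) ≤ τ ∧ τ - entryTime (η - τ) ≤ 1 := by
  obtain ⟨h0, h1⟩ := hη
  rcases le_total 0 (η - τ) with h | h
  · rw [entryTime_of_nonneg h]; constructor <;> linarith
  · rw [entryTime_of_nonpos h]; constructor <;> linarith

theorem exp_integral_deriv_le (hK : IsBoundedC2 K M) {X : ℝ → ℝ} {a b : ℝ} (hab : a ≤ b)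
    (hab1 : b - a ≤ 1) : Real.exp (∫ r in a..b, deriv K (X r)) ≤ Real.exp M := by
  refine Real.exp_le_exp.2 ((le_abs_self _).trans ?_)
  have := intervalIntegral.norm_integral_le_of_norm_le_const (a := a) (b := b) (C := M)
    (f := fun r => deriv K (X r)) (fun r _ => hK.abs_deriv_le _)
  rw [abs_of_nonneg (sub_nonneg.2 hab)] at this
  exact this.trans (mul_le_of_le_one_right hK.nonneg hab1)

theorem abs_profileDeriv_le (hK : IsBoundedC2 K M) (hu : Continuous u) {τ η : ℝ} (hτ : 0 ≤ τ)
    (hη : η ∈ Icc (0 : ℝ) 1) :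
    |profileDeriv K u q τ η| ≤ |entrySlope u q (η - τ)| * Real.exp M := by
  obtain ⟨h1, h2⟩ := sub_entryTime_mem hτ hη
  rw [profileDeriv_eq hK hu, abs_mul, Real.abs_exp]
  exact mul_le_mul_of_nonneg_left (exp_integral_deriv_le hK h1 h2) (abs_nonneg _)

end Profile

/-! ### Stability in a weighted norm -/

/-- The doubly exponential weight `exp (l * exp (k * t))`. -/
noncomputable def weight (l k t : ℝ) : ℝ := Real.exp (l * Real.exp (k * t))

section Weight

variable {l k : ℝ}

theorem weight_pos (l k t : ℝ) : 0 < weight l k t := Real.exp_pos _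

theorem continuous_weight (l k : ℝ) : Continuous (weight l k) := by unfold weight; fun_prop

theorem hasDerivAt_weight (l k t : ℝ) :
    HasDerivAt (weight l k) (l * k * Real.exp (k * t) * weight l k t) t := by
  have h1 : HasDerivAt (fun t => k * t) k t := by simpa using (hasDerivAt_id t).const_mul k
  exact ((h1.exp.const_mul l).exp).congr_deriv (by unfold weight; ring)

theorem exp_le_weight (hl : 1 ≤ l) (t : ℝ) : Real.exp (k * t) ≤ weight l k t := by
  have h := Real.add_one_le_exp (l * Real.exp (k * t))
  have h0 := Real.exp_pos (k * t)
  unfold weight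
  nlinarith

theorem one_le_weight (hl : 0 ≤ l) (t : ℝ) : 1 ≤ weight l k t :=
  Real.one_le_exp (mul_nonneg hl (Real.exp_pos _).le)

/-- The derivative l k exp(kr) w of the weight dominates l exp(ka) w on [a, b]. The factor exp(ka)
pays for the growth of the entry slope at time a. -/
theorem mul_integral_weight_le (hl : 0 < l) (hk : 1 ≤ k) {a b : ℝ} (hab : a ≤ b) :
    l * Real.exp (k * a) * ∫ r in a..b, weight l k r ≤ weight l k b := by
  have hc : Continuous fun t => l * k * Real.exp (k * t) * weight l k t := by
    have := continuous_weight l k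
    fun_prop
  have h := intervalIntegral.integral_eq_sub_of_hasDerivAt
    (fun t _ => hasDerivAt_weight l k t) (hc.intervalIntegrable a b)
  have h2 : ∫ r in a..b, l * Real.exp (k * a) * weight l k r ≤
      ∫ r in a..b, l * k * Real.exp (k * r) * weight l k r := by
    refine intervalIntegral.integral_mono_on hab
      ((continuous_const.mul (continuous_weight l k)).intervalIntegrable _ _)
      (hc.intervalIntegrable _ _) fun r hr => ?_
    have h3 : Real.exp (k * a) ≤ Real.exp (k * r) := by
      have := hr.1
      gcongr
    have h4 : l * Real.exp (k * a) ≤ l * k * Real.exp (k * r) := by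
      calc l * Real.exp (k * a) ≤ l * Real.exp (k * r) := by gcongr
        _ = l * 1 * Real.exp (k * r) := by ring
        _ ≤ l * k * Real.exp (k * r) := by gcongr
    exact mul_le_mul_of_nonneg_right h4 (weight_pos _ _ _).le
  rw [intervalIntegral.integral_const_mul, h] at h2
  linarith [weight_pos l k a]

/-- Going back by one time unit lowers the exponent of the weight by at least l ≥ M + 2: the M
cancels exp M and the 2 supplies exp 2 ≥ 4. This handles the delayed term u(τ - 1). -/
theorem exp_mul_weight_sub_one_le {M : ℝ} (hM : 0 ≤ M) (hl : M + 2 ≤ l) (hk : 1 ≤ k) {t : ℝ}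
    (ht : 1 ≤ t) : Real.exp M * weight l k (t - 1) ≤ weight l k t / 4 := by
  have h4 : (4 : ℝ) ≤ Real.exp 2 := by
    have h := Real.add_one_le_exp (1 : ℝ)
    have : Real.exp 2 = Real.exp 1 * Real.exp 1 := by rw [← Real.exp_add]; norm_num
    nlinarith
  have h1 : 1 + Real.exp (k * (t - 1)) ≤ Real.exp (k * t) := by
    have e1 : Real.exp (k * t) = Real.exp (k * (t - 1)) * Real.exp k := by
      rw [← Real.exp_add]; ring_nf
    have e2 := Real.add_one_le_exp k
    have e3 : 1 ≤ Real.exp (k * (t - 1)) :=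
      Real.one_le_exp (mul_nonneg (by linarith) (by linarith))
    nlinarith
  have h2 : M + 2 + l * Real.exp (k * (t - 1)) ≤ l * Real.exp (k * t) := by nlinarith
  have h3 := Real.exp_le_exp.2 h2
  rw [Real.exp_add, Real.exp_add] at h3
  have h5 : 0 < Real.exp M * weight l k (t - 1) := mul_pos (Real.exp_pos _) (weight_pos _ _ _)
  change Real.exp M * Real.exp 2 * weight l k (t - 1) ≤ weight l k t at h3
  nlinarith

end Weight

theorem abs_exp_sub_exp_le {a b M : ℝ} (ha : a ≤ M) (hb : b ≤ M) :
    |Real.exp a - Real.exp b| ≤ Real.exp M * |a - b| := by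
  have := Convex.norm_image_sub_le_of_norm_deriv_le (f := Real.exp) (s := Iic M) (C := Real.exp M)
    (fun z _ => Real.differentiableAt_exp)
    (fun z hz => by simpa using hz) (convex_Iic M) hb ha
  simpa using this

/-! ### Comparison of two profiles in the weighted norm -/

section Stability

variable {K u v q₁ q₂ : ℝ → ℝ} {M l k A T δ S : ℝ}

/-- A strict comparison argument. At entry the trajectories carry values of q₁ and q₂ at one point,
so they differ by at most δ; at a contact with the barrier (δ + S) w, its slope exceeds S w + M (δ +
S) w because l ≥ M + 2 and δ + S > 0. -/
theorem abs_flow_label_sub_le (hK : IsBoundedC2 K M) (hu : Continuous u) (hv : Continuous v)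
    (hl : M + 2 ≤ l) (hk : 1 ≤ k) (hδ : 0 ≤ δ) (hS : 0 ≤ S) (hδS : 0 < δ + S)
    (huv : ∀ t ∈ Icc 0 T, |u t - v t| ≤ S * weight l k t)
    (hq : ∀ y ∈ Icc (0 : ℝ) 1, |q₁ y - q₂ y| ≤ δ) (y : ℝ) {t : ℝ} (ht : t ∈ Icc (entryTime y) T) :
    |flow K u t (label K u q₁ y) - flow K v t (label K v q₂ y)| ≤ (δ + S) * weight l k t := by
  have hM := hK.nonneg
  have hX := isTrajectory_flow hK hu (label K u q₁ y)
  have hY := isTrajectory_flow hK hv (label K v q₂ y)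
  refine image_norm_le_of_norm_deriv_right_lt_deriv_boundary
    (f := fun t => flow K u t (label K u q₁ y) - flow K v t (label K v q₂ y))
    (B := fun t => (δ + S) * weight l k t) (a := entryTime y) (b := T)
    (hX.continuous.sub hY.continuous).continuousOn
    (fun r _ => ((hX r).fun_sub (hY r)).hasDerivWithinAt) ?_
    (fun r => (hasDerivAt_weight l k r).const_mul (δ + S)) ?_ ht
  · rw [flow_entryTime_label hK hu, flow_entryTime_label hK hv]
    have h1 := hq _ (clamp01_mem y)
    have h2 := one_le_weight (k := k) (by linarith : 0 ≤ l) (entryTime y)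
    rw [Real.norm_eq_abs]
    nlinarith
  · intro r hr hfr
    have hr0 : 0 ≤ r := (entryTime_nonneg y).trans hr.1
    rw [Real.norm_eq_abs] at hfr ⊢
    have h1 := huv r ⟨hr0, hr.2.le⟩
    have h2 := hK.lipschitz (flow K u r (label K u q₁ y)) (flow K v r (label K v q₂ y))
    rw [hfr] at h2
    have h3 : 1 ≤ Real.exp (k * r) := Real.one_le_exp (mul_nonneg (by linarith) hr0)
    have h4 := weight_pos l k r
    have h5 : |u r + K (flow K u r (label K u q₁ y)) - (v r + K (flow K v r (label K v q₂ y)))| ≤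
        S * weight l k r + M * ((δ + S) * weight l k r) := by
      rw [add_sub_add_comm]
      exact (abs_add_le _ _).trans (add_le_add h1 h2)
    refine h5.trans_lt ?_
    have h6 : l * 1 * 1 ≤ l * k * Real.exp (k * r) := by
      have : 0 ≤ l := by linarith
      gcongr
    have h7 : 0 < (δ + S) * weight l k r := mul_pos hδS h4
    calc S * weight l k r + M * ((δ + S) * weight l k r)
        ≤ (δ + S) * weight l k r + M * ((δ + S) * weight l k r) := by
          gcongr
          linarith
      _ < l * ((δ + S) * weight l k r) := by nlinarith
      _ ≤ (l * k * Real.exp (k * r)) * ((δ + S) * weight l k r) := by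
          gcongr
          linarith
      _ = (δ + S) * (l * k * Real.exp (k * r) * weight l k r) := by ring

theorem abs_profile_sub_le (hK : IsBoundedC2 K M) (hu : Continuous u) (hv : Continuous v)
    (hl : M + 2 ≤ l) (hk : 1 ≤ k) (hδ : 0 ≤ δ) (hS : 0 ≤ S) (hδS : 0 < δ + S)
    (huv : ∀ t ∈ Icc 0 T, |u t - v t| ≤ S * weight l k t)
    (hq : ∀ y ∈ Icc (0 : ℝ) 1, |q₁ y - q₂ y| ≤ δ) {τ η : ℝ} (hτ : τ ∈ Icc 0 T)
    (hη : η ∈ Icc (0 : ℝ) 1) :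
    |profile K u q₁ τ η - profile K v q₂ τ η| ≤ (δ + S) * weight l k τ :=
  abs_flow_label_sub_le hK hu hv hl hk hδ hS hδS huv hq _
    ⟨(sub_entryTime_mem hτ.1 hη).1, hτ.2⟩

/-- Write g₁e₁ - g₂e₂ = (g₁ - g₂)e₁ + g₂(e₁ - e₂), with g the entry slopes and e the exponential
factors. The growth of g₂ is absorbed by `mul_integral_weight_le`, and l ≥ 4 A exp(M) M produces the
factor 1/4. Only the second solution needs a growth bound. -/
theorem abs_profileDeriv_sub_le (hK : IsBoundedC2 K M) (hu : Continuous u) (hv : Continuous v)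
    (hl : M + 2 ≤ l) (hlA : 4 * A * Real.exp M * M ≤ l) (hk : 1 ≤ k) (hδ : 0 ≤ δ) (hS : 0 ≤ S)
    (hδS : 0 < δ + S) (huv : ∀ t ∈ Icc 0 T, |u t - v t| ≤ S * weight l k t)
    (hq : ∀ y ∈ Icc (0 : ℝ) 1, |q₁ y - q₂ y| ≤ δ) {τ η : ℝ} (hτ : τ ∈ Icc 0 T)
    (hη : η ∈ Icc (0 : ℝ) 1)
    (hA : |entrySlope v q₂ (η - τ)| ≤ A * Real.exp (k * entryTime (η - τ))) :
    |profileDeriv K u q₁ τ η - profileDeriv K v q₂ τ η| ≤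
      Real.exp M * |entrySlope u q₁ (η - τ) - entrySlope v q₂ (η - τ)| +
        (δ + S) / 4 * weight l k τ := by
  have hM := hK.nonneg
  obtain ⟨ha, ha1⟩ := sub_entryTime_mem hτ.1 hη
  rw [profileDeriv_eq hK hu, profileDeriv_eq hK hv]
  set y := η - τ
  set a := entryTime y
  set g₁ := entrySlope u q₁ y
  set g₂ := entrySlope v q₂ y
  have hcX : Continuous fun r => deriv K (flow K u r (label K u q₁ y)) :=
    hK.continuous_deriv.comp (isTrajectory_flow hK hu _).continuous
  have hcY : Continuous fun r => deriv K (flow K v r (label K v q₂ y)) :=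
    hK.continuous_deriv.comp (isTrajectory_flow hK hv _).continuous
  have he₁ := exp_integral_deriv_le hK (X := fun r => flow K u r (label K u q₁ y)) ha ha1
  have he₂ := exp_integral_deriv_le hK (X := fun r => flow K v r (label K v q₂ y)) ha ha1
  set I₁ := ∫ r in a..τ, deriv K (flow K u r (label K u q₁ y)) with hI₁
  set I₂ := ∫ r in a..τ, deriv K (flow K v r (label K v q₂ y)) with hI₂
  have hI : |I₁ - I₂| ≤ M * (δ + S) * ∫ r in a..τ, weight l k r := by
    rw [hI₁, hI₂, ← intervalIntegral.integral_sub (hcX.intervalIntegrable _ _)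
      (hcY.intervalIntegrable _ _), ← intervalIntegral.integral_const_mul]
    refine intervalIntegral.norm_integral_le_of_norm_le (μ := MeasureTheory.volume)
      (f := fun r => deriv K (flow K u r (label K u q₁ y)) - deriv K (flow K v r (label K v q₂ y)))
      (g := fun r => M * (δ + S) * weight l k r) ha
      (Eventually.of_forall fun r hr => ?_)
      ((continuous_const.mul (continuous_weight l k)).intervalIntegrable _ _)
    rw [mul_assoc]
    exact (hK.deriv_lipschitz _ _).trans (mul_le_mul_of_nonneg_left
      (abs_flow_label_sub_le hK hu hv hl hk hδ hS hδS huv hq y ⟨hr.1.le, hr.2.trans hτ.2⟩) hM)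
  have hW0 : 0 ≤ ∫ r in a..τ, weight l k r :=
    intervalIntegral.integral_nonneg ha fun _ _ => (weight_pos _ _ _).le
  have hW := mul_integral_weight_le (l := l) (by linarith) hk ha
  have hee : |Real.exp I₁ - Real.exp I₂| ≤
      Real.exp M * (M * (δ + S) * ∫ r in a..τ, weight l k r) :=
    (abs_exp_sub_exp_le (Real.exp_le_exp.1 he₁) (Real.exp_le_exp.1 he₂)).trans
      (mul_le_mul_of_nonneg_left hI (Real.exp_pos _).le)
  have h2 : |g₂| * |Real.exp I₁ - Real.exp I₂| ≤ (δ + S) / 4 * weight l k τ := by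
    calc |g₂| * |Real.exp I₁ - Real.exp I₂|
        ≤ (A * Real.exp (k * a)) *
          (Real.exp M * (M * (δ + S) * ∫ r in a..τ, weight l k r)) :=
          mul_le_mul hA hee (abs_nonneg _) ((abs_nonneg _).trans hA)
      _ = (δ + S) / 4 * ((4 * A * Real.exp M * M) *
          (Real.exp (k * a) * ∫ r in a..τ, weight l k r)) := by ring
      _ ≤ (δ + S) / 4 * (l * (Real.exp (k * a) * ∫ r in a..τ, weight l k r)) := by
          have := Real.exp_pos (k * a)
          gcongr
      _ ≤ (δ + S) / 4 * weight l k τ := by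
          rw [← mul_assoc l]
          gcongr
  have h1 : |g₁ - g₂| * Real.exp I₁ ≤ Real.exp M * |g₁ - g₂| := by
    rw [mul_comm]
    exact mul_le_mul_of_nonneg_right he₁ (abs_nonneg _)
  calc |g₁ * Real.exp I₁ - g₂ * Real.exp I₂|
      = |(g₁ - g₂) * Real.exp I₁ + g₂ * (Real.exp I₁ - Real.exp I₂)| := by congr 1; ring
    _ ≤ |g₁ - g₂| * Real.exp I₁ + |g₂| * |Real.exp I₁ - Real.exp I₂| := by
        refine (abs_add_le _ _).trans (le_of_eq ?_)
        rw [abs_mul, abs_mul, Real.abs_exp]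
    _ ≤ _ := add_le_add h1 h2

theorem abs_entrySlope_sub_le (hS : 0 ≤ S) (hδ : 0 ≤ δ)
    (hcu : u 0 + K 0 = dEta q₁ 0) (hcv : v 0 + K 0 = dEta q₂ 0)
    (huv : ∀ t ∈ Icc 0 T, |u t - v t| ≤ S * weight l k t)
    (hq' : ∀ y ∈ Icc (0 : ℝ) 1, |dEta q₁ y - dEta q₂ y| ≤ δ) {y : ℝ} (hy : -T ≤ y) :
    |entrySlope u q₁ y - entrySlope v q₂ y| ≤ δ + S * weight l k (entryTime y) := by
  have hw := weight_pos l k (entryTime y)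
  rcases le_total 0 y with h | h
  · rw [entrySlope_of_nonneg _ _ h, entrySlope_of_nonneg _ _ h]
    have := hq' _ (clamp01_mem y)
    nlinarith [mul_nonneg hS hw.le]
  · rw [entrySlope_of_nonpos hcu h, entrySlope_of_nonpos hcv h, add_sub_add_right_eq_sub]
    rw [entryTime_of_nonpos h]
    have := huv (-y) ⟨by linarith, by linarith⟩
    linarith

/-- The line through (τ, 1) enters at time 0 if τ ≤ 1, where the entry slopes differ by at most δ,
and at time τ - 1 otherwise, where the delay costs only S w(τ)/4. With the S/4 from the exponent, S
appears with the total factor 1/2. -/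
theorem abs_profileDeriv_one_sub_le (hK : IsBoundedC2 K M) (hu : Continuous u)
    (hv : Continuous v) (hl : M + 2 ≤ l) (hlA : 4 * A * Real.exp M * M ≤ l) (hk : 1 ≤ k)
    (hδ : 0 ≤ δ) (hS : 0 ≤ S) (hδS : 0 < δ + S)
    (hcu : u 0 + K 0 = dEta q₁ 0) (hcv : v 0 + K 0 = dEta q₂ 0)
    (huv : ∀ t ∈ Icc 0 T, |u t - v t| ≤ S * weight l k t)
    (hq : ∀ y ∈ Icc (0 : ℝ) 1, |q₁ y - q₂ y| ≤ δ)
    (hq' : ∀ y ∈ Icc (0 : ℝ) 1, |dEta q₁ y - dEta q₂ y| ≤ δ) {τ : ℝ} (hτ : τ ∈ Icc 0 T)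
    (hA : |entrySlope v q₂ (1 - τ)| ≤ A * Real.exp (k * entryTime (1 - τ))) :
    |profileDeriv K u q₁ τ 1 - profileDeriv K v q₂ τ 1| ≤
      Real.exp M * δ + (δ + 2 * S) / 4 * weight l k τ := by
  have h := abs_profileDeriv_sub_le hK hu hv hl hlA hk hδ hS hδS huv hq hτ
    (right_mem_Icc.2 zero_le_one) hA
  have hw := weight_pos l k τ
  suffices Real.exp M * |entrySlope u q₁ (1 - τ) - entrySlope v q₂ (1 - τ)| ≤
      Real.exp M * δ + S / 4 * weight l k τ by linarith
  rcases le_total τ 1 with h1 | h1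
  · have h2 : 0 ≤ 1 - τ := by linarith
    rw [entrySlope_of_nonneg _ _ h2, entrySlope_of_nonneg _ _ h2]
    have h3 := mul_le_mul_of_nonneg_left (hq' _ (clamp01_mem (1 - τ))) (Real.exp_pos M).le
    have : 0 ≤ S / 4 * weight l k τ := by positivity
    linarith
  · have h2 : 1 - τ ≤ 0 := by linarith
    rw [entrySlope_of_nonpos hcu h2, entrySlope_of_nonpos hcv h2, add_sub_add_right_eq_sub,
      neg_sub]
    have h3 := mul_le_mul_of_nonneg_left (huv (τ - 1) ⟨by linarith, by linarith [hτ.2]⟩)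
      (Real.exp_pos M).le
    have h4 := mul_le_mul_of_nonneg_left (exp_mul_weight_sub_one_le hK.nonneg hl hk h1) hS
    have : 0 ≤ Real.exp M * δ := by positivity
    linarith

end Stability

/-! ### Global existence of the inflow, ignoring its sign -/

theorem exists_abs_dEta_le {q : ℝ → ℝ} (hq : ContDiffOn ℝ 1 q (Icc 0 1)) :
    ∃ A, 0 ≤ A ∧ ∀ y ∈ Icc (0 : ℝ) 1, |dEta q y| ≤ A := by
  obtain ⟨A, hA⟩ := isCompact_Icc.exists_bound_of_continuousOn (continuousOn_dEta hq)
  exact ⟨A, (norm_nonneg _).trans (hA 0 (left_mem_Icc.2 zero_le_one)), hA⟩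

theorem profileDeriv_zero_one {K u q : ℝ → ℝ} : profileDeriv K u q 0 1 = dEta q 1 := by
  rw [profileDeriv, flowDeriv_zero, sub_zero, labelDeriv_of_mem (right_mem_Icc.2 zero_le_one),
    one_mul]

/-- Dropping the requirement u > 0 makes the fixed point problem global in time. Boundedness of K'
keeps iterates within a fixed exponential growth bound, and the doubly exponential weight makes the
map a contraction there. -/
theorem exists_inflow {K q : ℝ → ℝ} {M Φ : ℝ} (hK : IsBoundedC2 K M)
    (hq : ContDiffOn ℝ 1 q (Icc 0 1)) (hcompat : dEta q 1 - dEta q 0 = K Φ - K 0) :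
    ∃ u : ℝ → ℝ, Continuous u ∧ u 0 + K 0 = dEta q 0 ∧
      ∀ τ, 0 ≤ τ → u τ = profileDeriv K u q τ 1 - K Φ := by
  have hM := hK.nonneg
  obtain ⟨A₁, hA₁0, hA₁⟩ := exists_abs_dEta_le hq
  obtain ⟨c, hc⟩ : ∃ z, z = dEta q 0 - K 0 := ⟨_, rfl⟩
  have hc' : c = dEta q 1 - K Φ := by rw [hc]; linarith
  obtain ⟨b, hb⟩ : ∃ z, z = |K 0| + |K Φ| := ⟨_, rfl⟩
  -- With k = M + 1 the delayed term satisfies exp(k(τ - 1)) exp M = exp(kτ)/e ≤ exp(kτ)/2.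
  obtain ⟨k, hk⟩ : ∃ z, z = M + 1 := ⟨_, rfl⟩
  have hk1 : 1 ≤ k := by linarith
  -- Half of A₀ pays for the terms that do not involve u; the other half is what the delayed term
  -- returns, so the growth bound is preserved.
  obtain ⟨A₀, hA₀⟩ : ∃ z, z = 2 * ((A₁ + b) * Real.exp M + b) := ⟨_, rfl⟩
  have hb0 : 0 ≤ b := by rw [hb]; positivity
  have hA₀0 : 0 ≤ A₀ := by rw [hA₀]; positivity
  have heM : 1 ≤ Real.exp M := Real.one_le_exp hM
  have hcA : |c| ≤ A₀ := by
    have h1 := hA₁ 1 (right_mem_Icc.2 zero_le_one)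
    have h2 := abs_sub (dEta q 1) (K Φ)
    have h3 := abs_nonneg (K 0)
    rw [hc']
    nlinarith
  obtain ⟨A, hAdef⟩ : ∃ z, z = A₀ + A₁ + b := ⟨_, rfl⟩
  have hA0 : 0 ≤ A := by rw [hAdef]; positivity
  obtain ⟨l, hl⟩ : ∃ z, z = M + 2 + 4 * A * Real.exp M * M := ⟨_, rfl⟩
  have hl1 : M + 2 ≤ l := by
    have : 0 ≤ 4 * A * Real.exp M * M := by positivity
    linarith
  have hl2 : 4 * A * Real.exp M * M ≤ l := by linarith
  have hexp1 : ∀ t, 0 ≤ t → 1 ≤ Real.exp (k * t) := fun t ht =>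
    Real.one_le_exp (mul_nonneg (by linarith) ht)
  -- Inflows live on all of ℝ for convenience; negative times are frozen through `max t 0`. The
  -- prescribed value at 0 preserves first-order compatibility along the iteration.
  set S : Set (ℝ → ℝ) := {u | Continuous u ∧ u 0 = c ∧
    ∀ t, |u t| ≤ A₀ * Real.exp (k * max t 0)} with hS
  have hcS : ∀ u ∈ S, u 0 + K 0 = dEta q 0 := by
    rintro u ⟨-, hu0, -⟩
    rw [hu0, hc]; ring
  have hentry : ∀ u ∈ S, ∀ y, |entrySlope u q y| ≤ A * Real.exp (k * entryTime y) := by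
    intro u hu y
    have hE := hexp1 _ (entryTime_nonneg y)
    rcases le_total 0 y with h | h
    · rw [entrySlope_of_nonneg _ _ h]
      have := hA₁ _ (clamp01_mem y)
      nlinarith
    · rw [entrySlope_of_nonpos (hcS u hu) h]
      have h1 := hu.2.2 (-y)
      change |u (-y)| ≤ A₀ * Real.exp (k * entryTime y) at h1
      have h2 := abs_add_le (u (-y)) (K 0)
      have h3 : |K 0| ≤ b := by rw [hb]; linarith [abs_nonneg (K Φ)]
      nlinarith
  set F : (ℝ → ℝ) → ℝ → ℝ := fun u t => profileDeriv K u q (max t 0) 1 - K Φ with hF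
  have h1mem : (1 : ℝ) ∈ Icc (0 : ℝ) 1 := right_mem_Icc.2 zero_le_one
  have hFS : ∀ u ∈ S, F u ∈ S := by
    intro u hu
    refine ⟨?_, ?_, fun t => ?_⟩
    · exact ((continuous_profileDeriv hK hu.1 hq).comp
        ((continuous_id.max continuous_const).prodMk continuous_const)).sub continuous_const
    · simp [hF, profileDeriv_zero_one, hc']
    · set τ := max t 0
      have hτ : 0 ≤ τ := le_max_right _ _
      have h1 := abs_profileDeriv_le (q := q) hK hu.1 hτ h1mem
      have h2 : |F u t| ≤ |profileDeriv K u q τ 1| + |K Φ| := abs_sub _ _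
      have hKΦ : |K Φ| ≤ b := by rw [hb]; linarith [abs_nonneg (K 0)]
      have hE := hexp1 τ hτ
      refine h2.trans ?_
      suffices |entrySlope u q (1 - τ)| * Real.exp M ≤
          A₀ / 2 * Real.exp (k * τ) + (A₁ + b) * Real.exp M by nlinarith
      rcases le_total τ 1 with h | h
      · rw [entrySlope_of_nonneg _ _ (by linarith : 0 ≤ 1 - τ)]
        have h3 := hA₁ _ (clamp01_mem (1 - τ))
        have h4 : 0 ≤ A₀ / 2 * Real.exp (k * τ) := by positivity
        nlinarith
      · rw [entrySlope_of_nonpos (hcS u hu) (by linarith : 1 - τ ≤ 0), neg_sub]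
        have h3 := hu.2.2 (τ - 1)
        rw [max_eq_left (by linarith : 0 ≤ τ - 1)] at h3
        have h4 := abs_add_le (u (τ - 1)) (K 0)
        have h5 : |K 0| ≤ b := by rw [hb]; linarith [abs_nonneg (K Φ)]
        have h6 : Real.exp (k * (τ - 1)) * Real.exp M ≤ Real.exp (k * τ) / 2 := by
          have e1 : Real.exp (k * τ) = Real.exp (k * (τ - 1)) * Real.exp M * Real.exp 1 := by
            rw [← Real.exp_add, ← Real.exp_add]
            congr 1
            rw [hk]; ring
          have e2 := Real.add_one_le_exp (1 : ℝ)
          have e3 : 0 < Real.exp (k * (τ - 1)) * Real.exp M := by positivity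
          nlinarith
        calc |u (τ - 1) + K 0| * Real.exp M
            ≤ (A₀ * Real.exp (k * (τ - 1)) + b) * Real.exp M := by gcongr; linarith
          _ = A₀ * (Real.exp (k * (τ - 1)) * Real.exp M) + b * Real.exp M := by ring
          _ ≤ A₀ * (Real.exp (k * τ) / 2) + (A₁ + b) * Real.exp M := by gcongr; linarith
          _ = _ := by ring
  have hconst : (fun _ => c) ∈ S := by
    refine ⟨continuous_const, rfl, fun t => hcA.trans ?_⟩
    have := hexp1 (max t 0) (le_max_right _ _)
    nlinarith
  obtain ⟨u, huS, hu⟩ : ∃ u ∈ S, F u = u := by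
    refine exists_fixedPoint_of_weighted_contraction (w := fun t => weight l k (max t 0))
      (u₀ := fun _ => c) (C := 2 * A₀)
      ((continuous_weight l k).comp (continuous_id.max continuous_const))
      (fun t => weight_pos _ _ _) (fun u hu => hu.1) ?_ hFS hconst ?_ ?_
    · intro U v hU hv hUv
      refine ⟨hv, tendsto_nhds_unique (hUv 0) ?_, fun t => ?_⟩
      · simp only [(hU _).2.1]
        exact tendsto_const_nhds
      · exact le_of_tendsto (hUv t).abs (Eventually.of_forall fun n => (hU n).2.2 t)
    · intro t
      have h1 := (hFS _ hconst).2.2 t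
      have h2 := hconst.2.2 t
      have h3 := exp_le_weight (k := k) (by linarith : 1 ≤ l) (max t 0)
      refine (abs_sub _ _).trans ?_
      nlinarith
    · intro u hu v hv s hs huv t
      have ht : max t 0 ∈ Icc 0 (max t 0) := ⟨le_max_right _ _, le_rfl⟩
      -- With a single datum δ = 0, and the stability estimate reduces to contraction by 1/2.
      have h := abs_profileDeriv_one_sub_le (q₁ := q) (q₂ := q) (δ := 0) (S := s)
        (T := max t 0) hK hu.1 hv.1 hl1 hl2 hk1 le_rfl hs.le (by linarith) (hcS u hu) (hcS v hv)
        (fun r hr => by simpa [max_eq_left hr.1] using huv r) (by simp) (by simp) ht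
        (hentry v hv _)
      simp only [hF, sub_sub_sub_cancel_right]
      refine h.trans (le_of_eq ?_)
      ring
  refine ⟨u, huS.1, hcS u huS, fun τ hτ => ?_⟩
  have := congrFun hu τ
  simp only [hF, max_eq_left hτ] at this
  exact this.symm

/-! ### Classical solutions and profiles -/

section TimeInterval

variable {T : EReal}

theorem Icc_subset_timeInterval {t : ℝ} (ht : (t : EReal) < T) : Icc 0 t ⊆ timeInterval T :=
  fun _ hs => ⟨hs.1, (EReal.coe_le_coe_iff.2 hs.2).trans_lt ht⟩

theorem mem_timeInterval_of_le {s t : ℝ} (ht : t ∈ timeInterval T) (hs : 0 ≤ s) (hst : s ≤ t) :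
    s ∈ timeInterval T :=
  Icc_subset_timeInterval ht.2 ⟨hs, hst⟩

theorem zero_mem_timeInterval (hT : 0 < T) : (0 : ℝ) ∈ timeInterval T := ⟨le_rfl, by simpa⟩

theorem uniqueDiffOn_timeInterval (hT : 0 < T) : UniqueDiffOn ℝ (timeInterval T) := by
  have hc : Convex ℝ (timeInterval T) := by
    refine Set.OrdConnected.convex ⟨fun a ha b hb z hz => ?_⟩
    exact mem_timeInterval_of_le hb (ha.1.trans hz.1) hz.2
  refine uniqueDiffOn_convex hc ?_
  obtain ⟨t, ht0, ht⟩ := EReal.lt_iff_exists_real_btwn.1 hT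
  have ht0' : 0 < t := by exact_mod_cast ht0
  refine (nonempty_Ioo.2 ht0').mono (interior_maximal ?_ isOpen_Ioo)
  exact Ioo_subset_Icc_self.trans (Icc_subset_timeInterval ht)

theorem uniqueDiffOn_strip (hT : 0 < T) :
    UniqueDiffOn ℝ (timeInterval T ×ˢ Icc (0 : ℝ) 1) :=
  (uniqueDiffOn_timeInterval hT).prod (uniqueDiffOn_Icc zero_lt_one)

end TimeInterval

theorem HasFDerivWithinAt.hasDerivWithinAt_right {f : ℝ × ℝ → ℝ} {f' : ℝ × ℝ →L[ℝ] ℝ}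
    {s t : Set ℝ} {x y : ℝ} (h : HasFDerivWithinAt f f' (s ×ˢ t) (x, y)) (hx : x ∈ s) :
    HasDerivWithinAt (fun z => f (x, z)) (f' (0, 1)) t y :=
  h.comp_hasDerivWithinAt_of_eq y
    ((hasDerivWithinAt_const y t x).prodMk (hasDerivWithinAt_id y t)) (fun _ hz => ⟨hx, hz⟩) rfl

theorem HasFDerivWithinAt.hasDerivWithinAt_left {f : ℝ × ℝ → ℝ} {f' : ℝ × ℝ →L[ℝ] ℝ}
    {s t : Set ℝ} {x y : ℝ} (h : HasFDerivWithinAt f f' (s ×ˢ t) (x, y)) (hy : y ∈ t) :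
    HasDerivWithinAt (fun z => f (z, y)) (f' (1, 0)) s x :=
  h.comp_hasDerivWithinAt_of_eq x
    ((hasDerivWithinAt_id x s).prodMk (hasDerivWithinAt_const x s y)) (fun _ hz => ⟨hz, hy⟩) rfl

section Profile

variable {K u q : ℝ → ℝ} {M : ℝ}

theorem hasFDerivWithinAt_profile_strip (hK : IsBoundedC2 K M) (hu : Continuous u)
    (hq : ContDiffOn ℝ 1 q (Icc 0 1)) (hq0 : q 0 = 0) (hc : u 0 + K 0 = dEta q 0)
    {p : ℝ × ℝ} (hp : p ∈ Ici (0 : ℝ) ×ˢ Icc (0 : ℝ) 1) :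
    HasFDerivWithinAt (fun p : ℝ × ℝ => profile K u q p.1 p.2)
      ((u p.1 + K (profile K u q p.1 p.2) - profileDeriv K u q p.1 p.2) •
        ContinuousLinearMap.fst ℝ ℝ ℝ +
        profileDeriv K u q p.1 p.2 • ContinuousLinearMap.snd ℝ ℝ ℝ)
      (Ici (0 : ℝ) ×ˢ Icc (0 : ℝ) 1) p :=
  hasFDerivWithinAt_profile hK hu hq hq0 hc
    (fun z hz => by have h1 := hz.1; have h2 := hz.2.2; simp at h1; linarith) hp

theorem hasDerivWithinAt_profile_right (hK : IsBoundedC2 K M) (hu : Continuous u)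
    (hq : ContDiffOn ℝ 1 q (Icc 0 1)) (hq0 : q 0 = 0) (hc : u 0 + K 0 = dEta q 0)
    {τ η : ℝ} (hτ : 0 ≤ τ) (hη : η ∈ Icc (0 : ℝ) 1) :
    HasDerivWithinAt (profile K u q τ) (profileDeriv K u q τ η) (Icc 0 1) η :=
  ((hasFDerivWithinAt_profile_strip hK hu hq hq0 hc (p := (τ, η))
    ⟨hτ, hη⟩).hasDerivWithinAt_right hτ).congr_deriv (by simp)

theorem dEta_profile (hK : IsBoundedC2 K M) (hu : Continuous u)
    (hq : ContDiffOn ℝ 1 q (Icc 0 1)) (hq0 : q 0 = 0) (hc : u 0 + K 0 = dEta q 0)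
    {τ η : ℝ} (hτ : 0 ≤ τ) (hη : η ∈ Icc (0 : ℝ) 1) :
    dEta (profile K u q τ) η = profileDeriv K u q τ η :=
  (hasDerivWithinAt_profile_right hK hu hq hq0 hc hτ hη).derivWithin
    (uniqueDiffOn_Icc zero_lt_one η hη)

/-- Positivity of u gives N > 0 and the slope constraint at η = 1. It also gives monotonicity, since
the entry slope is either q' ≥ 0 or u + K(0) > 0. -/
theorem isClassicalSolution_profile {Φ : ℝ} {T : EReal} (hΦ : 0 ≤ Φ) (hKΦ : IsPhaseResponse Φ K)
    (hK : IsBoundedC2 K M) (hu : Continuous u) (hq : IsAdmissibleData Φ K q)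
    (hc : u 0 + K 0 = dEta q 0) (hueq : ∀ τ, 0 ≤ τ → u τ = profileDeriv K u q τ 1 - K Φ)
    (hT : 0 < T) (hpos : ∀ τ ∈ timeInterval T, 0 < u τ) :
    IsClassicalSolution Φ K q T (profile K u q) (fun τ => 1 / u τ) := by
  have hq1 := hq.contDiffOn
  have h1mem : (1 : ℝ) ∈ Icc (0 : ℝ) 1 := right_mem_Icc.2 zero_le_one
  have hsub : timeInterval T ×ˢ Icc (0 : ℝ) 1 ⊆ Ici (0 : ℝ) ×ˢ Icc (0 : ℝ) 1 :=
    prod_mono (fun _ h => h.1) subset_rfl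
  have hF := fun p hp => hasFDerivWithinAt_profile_strip hK hu hq1 hq.at_zero hc (p := p) hp
  refine
    { T_pos := hT
      contDiffOn := ?_
      monotoneOn := ?_
      continuousOn := ?_
      N_pos := fun τ hτ => one_div_pos.2 (hpos τ hτ)
      transport := ?_
      boundary := fun τ hτ => profile_zero_right hK hu hq.at_zero hτ.1
      firing_rate := ?_
      initial := fun η hη => profile_zero_left hK hu hη
      constraint := ?_ }
  · have := contDiffOn_succ_of_partials (n := 0) (uniqueDiffOn_strip hT)
      (fun p hp => (hF p (hsub hp)).mono hsub)
      (contDiffOn_zero.2 (((hu.comp continuous_fst).add (hK.continuous.comp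
        (continuous_profile hK hu hq1))).sub (continuous_profileDeriv hK hu hq1)).continuousOn)
      (contDiffOn_zero.2 (continuous_profileDeriv hK hu hq1).continuousOn)
    simpa using this
  · intro τ hτ
    have hd := fun η hη => hasDerivWithinAt_profile_right hK hu hq1 hq.at_zero hc hτ.1 (η := η) hη
    refine monotoneOn_of_deriv_nonneg (convex_Icc 0 1) (fun η hη => (hd η hη).continuousWithinAt)
      (fun η hη => ((hd η (interior_subset hη)).mono interior_subset).differentiableWithinAt)
      fun η hη => ?_
    have hη' : η ∈ Icc (0 : ℝ) 1 := interior_subset hη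
    rw [((hd η hη').hasDerivAt (mem_interior_iff_mem_nhds.1 hη)).deriv, profileDeriv_eq hK hu]
    refine mul_nonneg ?_ (Real.exp_pos _).le
    rcases le_total 0 (η - τ) with h | h
    · rw [entrySlope_of_nonneg _ _ h]
      exact hq.monotoneOn.derivWithin_nonneg
    · rw [entrySlope_of_nonpos hc h]
      have h1 := hpos (-(η - τ))
        (mem_timeInterval_of_le hτ (by linarith) (by linarith [hη'.1]))
      have h2 := hKΦ.pos 0 (left_mem_Icc.2 hΦ)
      linarith
  · exact continuousOn_const.div hu.continuousOn fun τ hτ => (hpos τ hτ).ne'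
  · intro τ hτ η hη
    have hη' := Ioo_subset_Icc_self hη
    rw [dEta_profile hK hu hq1 hq.at_zero hc hτ.1 hη', one_div_one_div]
    have h1 := (((hF (τ, η) (hsub ⟨hτ, hη'⟩)).mono hsub).hasDerivWithinAt_left hη').derivWithin
      (uniqueDiffOn_timeInterval hT τ hτ)
    simp only [dTau]
    rw [h1]
    simp
  · intro τ hτ
    rw [dEta_profile hK hu hq1 hq.at_zero hc hτ.1 h1mem, one_div_one_div]
    exact hueq τ hτ.1
  · intro τ hτ
    rw [dEta_profile hK hu hq1 hq.at_zero hc hτ.1 h1mem]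
    linarith [hueq τ hτ.1, hpos τ hτ]

end Profile

/-- The derivative of Q in the direction (1, 1) is 1/N + K(Q), so Q restricted to a characteristic
solves the trajectory ODE, and ODE uniqueness identifies it with the profile. -/
theorem IsClassicalSolution.eq_profile {Φ M : ℝ} {K q : ℝ → ℝ} {T : EReal} {Q : ℝ → ℝ → ℝ}
    {N : ℝ → ℝ} (h : IsClassicalSolution Φ K q T Q N) (hK : IsBoundedC2 K M)
    (hq : IsAdmissibleData Φ K q) {t₁ : ℝ} (ht₁0 : 0 ≤ t₁) (ht₁ : (t₁ : EReal) < T) :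
    ∃ u : ℝ → ℝ, Continuous u ∧ u 0 + K 0 = dEta q 0 ∧ ∀ τ ∈ Icc 0 t₁,
      u τ = 1 / N τ ∧ u τ = profileDeriv K u q τ 1 - K Φ ∧
      ∀ η ∈ Icc (0 : ℝ) 1, Q τ η = profile K u q τ η ∧
        dEta (Q τ) η = profileDeriv K u q τ η := by
  have h0mem : (0 : ℝ) ∈ Icc (0 : ℝ) 1 := left_mem_Icc.2 zero_le_one
  have h1mem : (1 : ℝ) ∈ Icc (0 : ℝ) 1 := right_mem_Icc.2 zero_le_one
  have hsub := Icc_subset_timeInterval ht₁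
  set s := timeInterval T ×ˢ Icc (0 : ℝ) 1 with hs
  set f : ℝ × ℝ → ℝ := fun p => Q p.1 p.2 with hf
  have hus : UniqueDiffOn ℝ s := uniqueDiffOn_strip h.T_pos
  have hF : ∀ p ∈ s, HasFDerivWithinAt f (fderivWithin ℝ f s p) s p := fun p hp =>
    (h.contDiffOn.differentiableOn (by norm_num) p hp).hasFDerivWithinAt
  have hFc : ContinuousOn (fderivWithin ℝ f s) s :=
    h.contDiffOn.continuousOn_fderivWithin hus le_rfl
  have hEta : ∀ τ ∈ timeInterval T, ∀ η ∈ Icc (0 : ℝ) 1,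
      dEta (Q τ) η = fderivWithin ℝ f s (τ, η) (0, 1) := fun τ hτ η hη =>
    ((hF (τ, η) ⟨hτ, hη⟩).hasDerivWithinAt_right hτ).derivWithin
      (uniqueDiffOn_Icc zero_lt_one η hη)
  have hTau : ∀ τ ∈ timeInterval T, ∀ η ∈ Icc (0 : ℝ) 1,
      dTau T Q τ η = fderivWithin ℝ f s (τ, η) (1, 0) := fun τ hτ η hη =>
    ((hF (τ, η) ⟨hτ, hη⟩).hasDerivWithinAt_left hη).derivWithin
      (uniqueDiffOn_timeInterval h.T_pos τ hτ)
  -- The equation is given only for 0 < η < 1; continuity of the derivatives extends it to η = 0 and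
  -- η = 1.
  have htrans : ∀ τ ∈ timeInterval T, ∀ η ∈ Icc (0 : ℝ) 1,
      fderivWithin ℝ f s (τ, η) (1, 1) = 1 / N τ + K (Q τ η) := by
    intro τ hτ
    have hmaps : MapsTo (fun η : ℝ => (τ, η)) (Icc 0 1) s := fun η hη => ⟨hτ, hη⟩
    have hcη : ContinuousOn (fun η : ℝ => (τ, η)) (Icc 0 1) := by fun_prop
    have hc1 : ContinuousOn (fun η => fderivWithin ℝ f s (τ, η) (1, 1)) (Icc 0 1) :=
      (hFc.comp hcη hmaps).clm_apply continuousOn_const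
    have hc2 : ContinuousOn (fun η => 1 / N τ + K (Q τ η)) (Icc 0 1) :=
      continuousOn_const.add (hK.continuous.comp_continuousOn
        (h.contDiffOn.continuousOn.comp hcη hmaps))
    refine EqOn.of_subset_closure (s := Ioo 0 1) (fun η hη => ?_) hc1 hc2 Ioo_subset_Icc_self
      (by rw [closure_Ioo zero_ne_one])
    have h1 := h.transport τ hτ η hη
    rw [hTau τ hτ η (Ioo_subset_Icc_self hη), hEta τ hτ η (Ioo_subset_Icc_self hη),
      ← map_add] at h1
    simpa using h1
  -- Freezing 1/N outside [0, t₁] makes it a continuous function on ℝ, as the flow requires.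
  set u : ℝ → ℝ := fun t => 1 / N (max 0 (min t₁ t)) with hu
  have hclamp : ∀ t, max 0 (min t₁ t) ∈ Icc 0 t₁ := fun t =>
    ⟨le_max_left _ _, max_le ht₁0 (min_le_left _ _)⟩
  have huc : Continuous u := by
    refine continuous_const.div (h.continuousOn.comp_continuous (by fun_prop)
      fun t => hsub (hclamp t)) fun t => (h.N_pos _ (hsub (hclamp t))).ne'
  have huN : ∀ τ ∈ Icc 0 t₁, u τ = 1 / N τ := by
    intro τ hτ
    simp only [hu]
    rw [min_eq_right hτ.2, max_eq_right hτ.1]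
  have h0 := zero_mem_timeInterval h.T_pos
  -- At the corner (0, 0) the time derivative vanishes by the boundary condition, so the equation
  -- reads q'(0) = u(0) + K(0).
  have hcomp : u 0 + K 0 = dEta q 0 := by
    have h1 := htrans 0 h0 0 h0mem
    have h2 : dTau T Q 0 0 = 0 := by
      have : derivWithin (fun s => Q s 0) (timeInterval T) 0 =
          derivWithin (fun _ => (0 : ℝ)) (timeInterval T) 0 :=
        derivWithin_congr (fun s hs => h.boundary s hs) (h.boundary 0 h0)
      simpa [dTau] using this
    have h3 : dEta (Q 0) 0 = dEta q 0 :=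
      derivWithin_congr (fun η hη => h.initial η hη) (h.initial 0 h0mem)
    rw [h.boundary 0 h0, ← huN 0 ⟨le_rfl, ht₁0⟩] at h1
    rw [← h1, ← h3, hEta 0 h0 0 h0mem]
    rw [hTau 0 h0 0 h0mem] at h2
    rw [show ((1 : ℝ), (1 : ℝ)) = (1, 0) + (0, 1) by simp, map_add, h2, zero_add]
  have hprof : ∀ τ ∈ Icc 0 t₁, ∀ η ∈ Icc (0 : ℝ) 1, Q τ η = profile K u q τ η := by
    intro τ hτ η hη
    set y := η - τ with hy
    obtain ⟨ha, ha1⟩ := sub_entryTime_mem hτ.1 hη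
    have hr : ∀ r ∈ Icc (entryTime y) τ, r ∈ Icc 0 t₁ ∧ r + y ∈ Icc (0 : ℝ) 1 := by
      intro r hr
      have h1 : -y ≤ entryTime y := le_max_left _ _
      refine ⟨⟨(entryTime_nonneg y).trans hr.1, hr.2.trans hτ.2⟩, by linarith [hr.1], ?_⟩
      linarith [hr.2, hη.2]
    have hder : ∀ r ∈ Icc (entryTime y) τ, HasDerivWithinAt (fun r => Q r (r + y))
        (u r + K (Q r (r + y))) (Icc (entryTime y) τ) r := by
      intro r hr'
      obtain ⟨h1, h2⟩ := hr r hr'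
      have h3 : HasDerivWithinAt (fun r => Q r (r + y))
          (fderivWithin ℝ f s (r, r + y) (1, 1)) (Icc (entryTime y) τ) r :=
        (hF (r, r + y) ⟨hsub h1, h2⟩).comp_hasDerivWithinAt_of_eq r
        ((hasDerivWithinAt_id r _).prodMk ((hasDerivWithinAt_id r _).add_const y))
        (fun z hz => ⟨hsub (hr z hz).1, (hr z hz).2⟩) rfl
      rw [htrans r (hsub h1) _ h2, ← huN r h1] at h3
      exact h3
    have heq := ODE_solution_unique (v := fun t x => u t + K x) (f := fun r => Q r (r + y))
      (g := fun r => flow K u r (label K u q y)) (a := entryTime y) (b := τ)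
      (fun t => hK.lipschitzWith (u t)) (fun r hr => (hder r hr).continuousWithinAt)
      (fun r hr => (hder r (Ico_subset_Icc_self hr)).mono_of_mem_nhdsWithin
        (Icc_mem_nhdsGE_of_mem hr))
      (isTrajectory_flow hK huc _).continuous.continuousOn
      (fun r _ => (isTrajectory_flow hK huc _ r).hasDerivWithinAt) ?_ (right_mem_Icc.2 ha)
    · simp only [hy, add_sub_cancel] at heq
      exact heq
    · simp only [flow_entryTime_label hK huc]
      rcases le_total 0 y with h1 | h1
      · have : y ∈ Icc (0 : ℝ) 1 := ⟨h1, by linarith [hη.2, hτ.1]⟩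
        rw [entryTime_of_nonneg h1, zero_add, clamp01_of_mem this, h.initial y this]
      · rw [entryTime_of_nonpos h1, clamp01_of_nonpos h1, hq.at_zero, neg_add_cancel]
        exact h.boundary _ (hsub ⟨by linarith, by linarith [hη.1, hτ.2]⟩)
  have hprofD : ∀ τ ∈ Icc 0 t₁, ∀ η ∈ Icc (0 : ℝ) 1,
      dEta (Q τ) η = profileDeriv K u q τ η := by
    intro τ hτ η hη
    rw [← dEta_profile hK huc hq.contDiffOn hq.at_zero hcomp hτ.1 hη]
    exact derivWithin_congr (fun z hz => hprof τ hτ z hz) (hprof τ hτ η hη)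
  refine ⟨u, huc, hcomp, fun τ hτ => ⟨huN τ hτ, ?_, fun η hη =>
    ⟨hprof τ hτ η hη, hprofD τ hτ η hη⟩⟩⟩
  rw [huN τ hτ, h.firing_rate τ (hsub hτ), hprofD τ hτ 1 h1mem]

/-! ### Lipschitz dependence on the data, uniqueness, and maximal solutions -/

theorem weight_mono {l k : ℝ} (hl : 0 ≤ l) (hk : 0 ≤ k) : Monotone (weight l k) := by
  intro s t hst
  unfold weight
  gcongr

/-- The constant depends on the reference pair (v, q₂) only, not on u or q₁, and no sign of u or v
is assumed. Hence it applies to perturbed inflows before their existence time is known. -/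
theorem exists_stability_const {K v q₂ : ℝ → ℝ} {M Φ T : ℝ} (hK : IsBoundedC2 K M)
    (hv : Continuous v) (hT : 0 ≤ T) (hq₂ : ContDiffOn ℝ 1 q₂ (Icc 0 1))
    (hcv : v 0 + K 0 = dEta q₂ 0)
    (hveq : ∀ τ ∈ Icc 0 T, v τ = profileDeriv K v q₂ τ 1 - K Φ) :
    ∃ C, 0 < C ∧ ∀ (u q₁ : ℝ → ℝ) (δ : ℝ), Continuous u → 0 < δ → u 0 + K 0 = dEta q₁ 0 →
      (∀ τ ∈ Icc 0 T, u τ = profileDeriv K u q₁ τ 1 - K Φ) →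
      (∀ y ∈ Icc (0 : ℝ) 1, |q₁ y - q₂ y| ≤ δ) →
      (∀ y ∈ Icc (0 : ℝ) 1, |dEta q₁ y - dEta q₂ y| ≤ δ) →
      ∀ τ ∈ Icc 0 T, |u τ - v τ| ≤ C * δ ∧ ∀ η ∈ Icc (0 : ℝ) 1,
        |profile K u q₁ τ η - profile K v q₂ τ η| ≤ C * δ ∧
        |profileDeriv K u q₁ τ η - profileDeriv K v q₂ τ η| ≤ C * δ := by
  have hM := hK.nonneg
  have heM : 1 ≤ Real.exp M := Real.one_le_exp hM
  obtain ⟨A, hA⟩ := (isCompact_Icc (a := -T) (b := 1)).exists_bound_of_continuousOn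
    (continuous_entrySlope hv hq₂).continuousOn
  have hA0 : 0 ≤ A := (norm_nonneg _).trans (hA 1 ⟨by linarith, le_rfl⟩)
  -- On a compact range the entry slopes of v are bounded, so k = 1 suffices in the weight.
  have hA' : ∀ y ∈ Icc (-T) 1, |entrySlope v q₂ y| ≤ A * Real.exp (1 * entryTime y) := by
    intro y hy
    have h1 : 1 ≤ Real.exp (1 * entryTime y) :=
      Real.one_le_exp (mul_nonneg zero_le_one (entryTime_nonneg y))
    exact (hA y hy).trans (le_mul_of_one_le_right hA0 h1)
  obtain ⟨l, hl1, hl2⟩ : ∃ l, M + 2 ≤ l ∧ 4 * A * Real.exp M * M ≤ l :=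
    ⟨max _ _, le_max_left _ _, le_max_right _ _⟩
  have hl0 : 0 ≤ l := by linarith
  obtain ⟨c, hc⟩ : ∃ c, c = 2 * Real.exp M + 1 := ⟨_, rfl⟩
  obtain ⟨w, hw⟩ : ∃ w, w = weight l 1 T := ⟨_, rfl⟩
  have hw1 : 1 ≤ w := hw ▸ one_le_weight hl0 T
  have hc0 : 0 < c := by rw [hc]; positivity
  have hwT : ∀ τ ≤ T, weight l 1 τ ≤ w := fun τ h => hw ▸ weight_mono hl0 zero_le_one h
  refine ⟨Real.exp M * (1 + c * w) + (1 + c) * w, by positivity, ?_⟩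
  intro u q₁ δ hu hδ hcu hueq hq hq'
  obtain ⟨t, ht, hmax⟩ := (isCompact_Icc (a := 0) (b := T)).exists_isMaxOn (nonempty_Icc.2 hT)
    (f := fun τ => |u τ - v τ| / weight l 1 τ)
    (((hu.sub hv).abs).div (continuous_weight l 1)
      fun τ => (weight_pos l 1 τ).ne').continuousOn
  obtain ⟨S, hS⟩ : ∃ S, S = |u t - v t| / weight l 1 t := ⟨_, rfl⟩
  have hS0 : 0 ≤ S := hS ▸ div_nonneg (abs_nonneg _) (weight_pos l 1 t).le
  have huv : ∀ τ ∈ Icc 0 T, |u τ - v τ| ≤ S * weight l 1 τ := fun τ hτ => by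
    rw [hS, ← div_le_iff₀ (weight_pos l 1 τ)]
    exact hmax hτ
  have hmem : ∀ τ ∈ Icc 0 T, ∀ η ∈ Icc (0 : ℝ) 1, η - τ ∈ Icc (-T) 1 := fun τ hτ η hη =>
    ⟨by linarith [hη.1, hτ.2], by linarith [hη.2, hτ.1]⟩
  -- At the point t where |u - v|/w attains its maximum S, the estimate gives S ≤ exp(M) δ + (δ +
  -- 2S)/4, and the S/2 is absorbed on the left.
  have hSc : S ≤ c * δ := by
    have h1 := abs_profileDeriv_one_sub_le hK hu hv hl1 hl2 le_rfl hδ.le hS0 (by linarith) hcu hcv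
      huv hq hq' ht (hA' _ (hmem t ht 1 (right_mem_Icc.2 zero_le_one)))
    rw [← sub_sub_sub_cancel_right _ _ (K Φ), ← hueq t ht, ← hveq t ht] at h1
    have h2 : |u t - v t| = S * weight l 1 t := by
      rw [hS, div_mul_cancel₀ _ (weight_pos l 1 t).ne']
    have h3 := one_le_weight (k := 1) hl0 t
    rw [h2] at h1
    have h4 : Real.exp M * δ ≤ Real.exp M * δ * weight l 1 t :=
      le_mul_of_one_le_right (by positivity) h3
    have h5 : S * weight l 1 t ≤ (Real.exp M * δ + (δ + 2 * S) / 4) * weight l 1 t := by linarith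
    have h6 := le_of_mul_le_mul_right h5 (weight_pos l 1 t)
    rw [hc]
    linarith
  intro τ hτ
  have hwτ := hwT τ hτ.2
  have hSw : (δ + S) * weight l 1 τ ≤ (1 + c) * w * δ := by
    calc (δ + S) * weight l 1 τ ≤ (δ + c * δ) * w := by
          have := weight_pos l 1 τ
          gcongr
      _ = _ := by ring
  have hwτ0 := weight_pos l 1 τ
  have hex : 0 ≤ Real.exp M * (1 + c * w) * δ := by positivity
  refine ⟨?_, fun η hη => ⟨?_, ?_⟩⟩
  · have := huv τ hτ
    nlinarith
  · have := abs_profile_sub_le hK hu hv hl1 le_rfl hδ.le hS0 (by linarith) huv hq hτ hη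
    nlinarith
  · have h1 := abs_profileDeriv_sub_le hK hu hv hl1 hl2 le_rfl hδ.le hS0 (by linarith) huv hq hτ hη
      (hA' _ (hmem τ hτ η hη))
    have h2 := abs_entrySlope_sub_le hS0 hδ.le hcu hcv huv hq' (hmem τ hτ η hη).1
    have h3 := hwT _ ((sub_entryTime_mem hτ.1 hη).1.trans hτ.2)
    have h4 : |entrySlope u q₁ (η - τ) - entrySlope v q₂ (η - τ)| ≤ (1 + c * w) * δ := by
      refine h2.trans ?_
      have : S * weight l 1 (entryTime (η - τ)) ≤ c * δ * w := by
        have := weight_pos l 1 (entryTime (η - τ))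
        gcongr
      linarith
    have h5 := mul_le_mul_of_nonneg_left h4 (Real.exp_pos M).le
    have h6 : 0 ≤ (δ + S) * weight l 1 τ := by positivity
    nlinarith

/-- Both solutions are profiles over the same datum, so the stability estimate holds for every δ >
0. -/
theorem IsClassicalSolution.unique {Φ M : ℝ} {K q : ℝ → ℝ} {T₁ T₂ : EReal}
    {Q₁ Q₂ : ℝ → ℝ → ℝ} {N₁ N₂ : ℝ → ℝ} (hK : IsBoundedC2 K M) (hq : IsAdmissibleData Φ K q)
    (h₁ : IsClassicalSolution Φ K q T₁ Q₁ N₁) (h₂ : IsClassicalSolution Φ K q T₂ Q₂ N₂) {τ : ℝ}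
    (hτ₁ : τ ∈ timeInterval T₁) (hτ₂ : τ ∈ timeInterval T₂) :
    N₁ τ = N₂ τ ∧ ∀ η ∈ Icc (0 : ℝ) 1, Q₁ τ η = Q₂ τ η := by
  obtain ⟨u, hu, hcu, hu'⟩ := h₁.eq_profile hK hq hτ₁.1 hτ₁.2
  obtain ⟨v, hv, hcv, hv'⟩ := h₂.eq_profile hK hq hτ₂.1 hτ₂.2
  obtain ⟨C, hC0, hC⟩ := exists_stability_const (Φ := Φ) hK hv hτ₁.1 hq.contDiffOn hcv
    (fun t ht => (hv' t ht).2.1)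
  have hmem : τ ∈ Icc 0 τ := right_mem_Icc.2 hτ₁.1
  have key : ∀ δ > 0, |u τ - v τ| ≤ δ ∧ ∀ η ∈ Icc (0 : ℝ) 1,
      |profile K u q τ η - profile K v q τ η| ≤ δ := by
    intro δ hδ
    have h := hC u q (δ / C) hu (by positivity) hcu (fun t ht => (hu' t ht).2.1)
      (fun y _ => by simp; positivity) (fun y _ => by simp; positivity) τ hmem
    rw [mul_div_cancel₀ _ hC0.ne'] at h
    exact ⟨h.1, fun η hη => (h.2 η hη).1⟩
  constructor
  · have h1 : u τ = v τ := eq_of_abs_sub_le_all fun δ hδ => (key δ hδ).1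
    rw [(hu' τ hmem).1, (hv' τ hmem).1, one_div, one_div] at h1
    exact inv_injective h1
  · intro η hη
    rw [((hu' τ hmem).2.2 η hη).1, ((hv' τ hmem).2.2 η hη).1]
    exact eq_of_abs_sub_le_all fun δ hδ => (key δ hδ).2 η hη

/-- The existence time is the first time at which the global inflow u is nonpositive, or ⊤ if there
is none. The last clause is the form needed for continuous dependence: positivity on [0, t] forces t
below that time. -/
theorem exists_maximalSolution {Φ M : ℝ} {K q : ℝ → ℝ} (hΦ : 0 ≤ Φ) (hKΦ : IsPhaseResponse Φ K)
    (hK : IsBoundedC2 K M) (hq : IsAdmissibleData Φ K q) :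
    ∃ (τs : EReal) (u : ℝ → ℝ), Continuous u ∧ u 0 + K 0 = dEta q 0 ∧
      (∀ τ, 0 ≤ τ → u τ = profileDeriv K u q τ 1 - K Φ) ∧
      IsMaximalSolution Φ K q τs (profile K u q) (fun τ => 1 / u τ) ∧
      (τs < ⊤ → Tendsto (fun τ => 1 / u τ) (𝓝[<] τs.toReal) atTop) ∧
      ∀ t : ℝ, 0 ≤ t → (∀ τ ∈ Icc 0 t, 0 < u τ) → (t : EReal) < τs := by
  obtain ⟨u, hu, hcu, hueq⟩ := exists_inflow hK hq.contDiffOn hq.compat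
  have hu0 : 0 < u 0 := by
    rw [hueq 0 le_rfl, profileDeriv_zero_one]
    linarith [hq.slope_gt]
  set Z : Set ℝ := Ici 0 ∩ {τ | u τ ≤ 0} with hZ
  rcases Z.eq_empty_or_nonempty with hZe | hZne
  · have hpos : ∀ τ, 0 ≤ τ → 0 < u τ := by
      intro τ hτ
      by_contra h
      have : τ ∈ Z := ⟨hτ, not_lt.1 h⟩
      simp [hZe] at this
    refine ⟨⊤, u, hu, hcu, hueq, ⟨isClassicalSolution_profile hΦ hKΦ hK hu hq hcu hueq (by simp)
      fun τ hτ => hpos τ hτ.1, fun _ _ _ _ => le_top⟩, fun h => absurd h (lt_irrefl _),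
      fun t _ _ => EReal.coe_lt_top t⟩
  · have hZc : IsClosed Z := isClosed_Ici.inter (isClosed_le hu continuous_const)
    have hZb : BddBelow Z := ⟨0, fun _ h => h.1⟩
    obtain ⟨s, hs⟩ : ∃ s, s = sInf Z := ⟨_, rfl⟩
    have hsZ : s ∈ Z := hs ▸ hZc.csInf_mem hZne hZb
    have hs0 : 0 < s := by
      refine lt_of_le_of_ne hsZ.1 fun h => ?_
      have := hsZ.2
      rw [← h] at this
      exact absurd hu0 (not_lt.2 this)
    have hpos : ∀ τ, 0 ≤ τ → τ < s → 0 < u τ := by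
      intro τ hτ hτs
      by_contra h
      have := csInf_le hZb (⟨hτ, not_lt.1 h⟩ : τ ∈ Z)
      rw [← hs] at this
      linarith
    have hcl : closure (Ico 0 s) = Icc 0 s := closure_Ico hs0.ne
    have hus : u s = 0 := by
      refine le_antisymm hsZ.2 ?_
      have : Icc 0 s ⊆ {τ | 0 ≤ u τ} := by
        rw [← hcl]
        exact closure_minimal (fun τ hτ => (hpos τ hτ.1 hτ.2).le)
          (isClosed_le continuous_const hu)
      exact this (right_mem_Icc.2 hs0.le)
    have hsol : IsClassicalSolution Φ K q (s : EReal) (profile K u q) (fun τ => 1 / u τ) :=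
      isClassicalSolution_profile hΦ hKΦ hK hu hq hcu hueq (by exact_mod_cast hs0)
        fun τ hτ => hpos τ hτ.1 (by exact_mod_cast hτ.2)
    refine ⟨s, u, hu, hcu, hueq, ⟨hsol, fun T' Q' N' h' => ?_⟩, fun _ => ?_, fun t ht htpos => ?_⟩
    · by_contra hlt
      rw [not_le] at hlt
      have hsub := Icc_subset_timeInterval hlt
      -- A longer solution has 1/N' = u before s by uniqueness, hence also at s by continuity; but
      -- u(s) = 0 whereas 1/N'(s) > 0.
      have heq : EqOn u (fun τ => 1 / N' τ) (Icc 0 s) := by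
        refine EqOn.of_subset_closure (s := Ico 0 s) (fun τ hτ => ?_) hu.continuousOn
          (continuousOn_const.div (h'.continuousOn.mono hsub)
            fun τ hτ => (h'.N_pos τ (hsub hτ)).ne') Ico_subset_Icc_self hcl.ge
        have := (hsol.unique hK hq h' ⟨hτ.1, by exact_mod_cast hτ.2⟩
          (hsub (Ico_subset_Icc_self hτ))).1
        simp only [← this, one_div_one_div]
      have h1 := heq (right_mem_Icc.2 hs0.le)
      have h2 := one_div_pos.2 (h'.N_pos s (hsub (right_mem_Icc.2 hs0.le)))
      simp only [hus] at h1
      linarith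
    · rw [EReal.toReal_coe]
      simp only [one_div]
      refine tendsto_inv_nhdsGT_zero.comp (tendsto_nhdsWithin_iff.2 ⟨?_, ?_⟩)
      · have := hu.tendsto s
        rw [hus] at this
        exact this.mono_left nhdsWithin_le_nhds
      · filter_upwards [Ioo_mem_nhdsLT hs0] with τ hτ
        exact hpos τ hτ.1.le hτ.2
    · by_contra hle
      have hst : s ≤ t := by exact_mod_cast not_lt.1 hle
      have := htpos s ⟨hs0.le, hst⟩
      linarith

theorem IsMaximalSolution.time_eq {Φ : ℝ} {K q : ℝ → ℝ} {T₁ T₂ : EReal} {Q₁ Q₂ : ℝ → ℝ → ℝ}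
    {N₁ N₂ : ℝ → ℝ} (h₁ : IsMaximalSolution Φ K q T₁ Q₁ N₁)
    (h₂ : IsMaximalSolution Φ K q T₂ Q₂ N₂) : T₁ = T₂ :=
  le_antisymm (h₂.2 _ _ _ h₁.1) (h₁.2 _ _ _ h₂.1)

/-! ### Continuous dependence -/

/-- The limit inflow is bounded below by a positive constant on [0, T], so nearby global inflows
remain positive there and their solutions survive past T. The stability estimate then compares all
quantities at once. -/
theorem eventually_close_of_tendstoC1 {Φ M : ℝ} {K : ℝ → ℝ} (hΦ : 0 ≤ Φ)
    (hKΦ : IsPhaseResponse Φ K) (hK : IsBoundedC2 K M) {q : ℝ → ℝ → ℝ}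
    (hq : ∀ ε, 0 ≤ ε → IsAdmissibleData Φ K (q ε)) (hqt : TendstoC1 q (q 0)) {τs : ℝ → EReal}
    {Q : ℝ → ℝ → ℝ → ℝ} {N : ℝ → ℝ → ℝ}
    (hmax : ∀ ε, 0 ≤ ε → IsMaximalSolution Φ K (q ε) (τs ε) (Q ε) (N ε))
    {T : ℝ} (hT : 0 ≤ T) (hTs : (T : EReal) < τs 0) {e : ℝ} (he : 0 < e) :
    ∀ᶠ ε in 𝓝[>] (0 : ℝ), (T : EReal) < τs ε ∧ ∀ τ ∈ Icc 0 T,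
      |1 / N ε τ - 1 / N 0 τ| ≤ e ∧ ∀ η ∈ Icc (0 : ℝ) 1, |Q ε τ η - Q 0 τ η| ≤ e ∧
        |dEta (Q ε τ) η - dEta (Q 0 τ) η| ≤ e := by
  obtain ⟨v, hv, hcv, hv'⟩ := (hmax 0 le_rfl).1.eq_profile hK (hq 0 le_rfl) hT hTs
  obtain ⟨C, hC0, hC⟩ := exists_stability_const (Φ := Φ) hK hv hT (hq 0 le_rfl).contDiffOn hcv
    (fun t ht => (hv' t ht).2.1)
  obtain ⟨t, ht, hmin⟩ := (isCompact_Icc (a := 0) (b := T)).exists_isMinOn (nonempty_Icc.2 hT)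
    hv.continuousOn
  have hvt : 0 < v t := by
    rw [(hv' t ht).1]
    exact one_div_pos.2 ((hmax 0 le_rfl).1.N_pos t (Icc_subset_timeInterval hTs ht))
  obtain ⟨d, hd0, hde, hdv⟩ : ∃ d, 0 < d ∧ d ≤ e ∧ d < v t :=
    ⟨min e (v t / 2), by positivity, min_le_left _ _, (min_le_right _ _).trans_lt (by linarith)⟩
  have hCd : C * (d / C) = d := mul_div_cancel₀ _ hC0.ne'
  have hδ : 0 < d / C := by positivity
  filter_upwards [Metric.tendstoUniformlyOn_iff.1 hqt.1 _ hδ,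
    Metric.tendstoUniformlyOn_iff.1 hqt.2 _ hδ, self_mem_nhdsWithin] with ε h1 h2 hε
  have hε0 : 0 ≤ ε := le_of_lt hε
  have h1' : ∀ y ∈ Icc (0 : ℝ) 1, |q ε y - q 0 y| ≤ d / C := fun y hy => by
    have := (h1 y hy).le
    rwa [dist_comm, Real.dist_eq] at this
  have h2' : ∀ y ∈ Icc (0 : ℝ) 1, |dEta (q ε) y - dEta (q 0) y| ≤ d / C := fun y hy => by
    have := (h2 y hy).le
    rwa [dist_comm, Real.dist_eq] at this
  -- Here `w` is the global inflow for the perturbed datum, defined on [0, T] whatever its sign.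
  -- Since |w - v| ≤ d < min v, it is positive, and this bounds the existence time from below.
  have hTε : (T : EReal) < τs ε := by
    obtain ⟨τ', w, hw, hcw, hweq, hwmax, -, hwT⟩ := exists_maximalSolution hΦ hKΦ hK (hq ε hε0)
    rw [(hmax ε hε0).time_eq hwmax]
    refine hwT T hT fun τ hτ => ?_
    have h3 := (hC w (q ε) _ hw hδ hcw (fun r hr => hweq r hr.1) h1' h2' τ hτ).1
    rw [hCd] at h3
    have h4 : v t ≤ v τ := hmin hτ
    linarith [(abs_le.1 h3).1]
  obtain ⟨u, hu, hcu, hu'⟩ := (hmax ε hε0).1.eq_profile hK (hq ε hε0) hT hTε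
  refine ⟨hTε, fun τ hτ => ?_⟩
  have h3 := hC u (q ε) _ hu hδ hcu (fun r hr => (hu' r hr).2.1) h1' h2' τ hτ
  rw [hCd] at h3
  rw [← (hu' τ hτ).1, ← (hv' τ hτ).1]
  refine ⟨h3.1.trans hde, fun η hη => ?_⟩
  rw [((hu' τ hτ).2.2 η hη).1, ((hv' τ hτ).2.2 η hη).1, ((hu' τ hτ).2.2 η hη).2,
    ((hv' τ hτ).2.2 η hη).2]
  exact ⟨(h3.2 η hη).1.trans hde, (h3.2 η hη).2.trans hde⟩

theorem le_liminf_existenceTime {Φ M : ℝ} {K : ℝ → ℝ} (hΦ : 0 ≤ Φ)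
    (hKΦ : IsPhaseResponse Φ K) (hK : IsBoundedC2 K M) {q : ℝ → ℝ → ℝ}
    (hq : ∀ ε, 0 ≤ ε → IsAdmissibleData Φ K (q ε)) (hqt : TendstoC1 q (q 0)) {τs : ℝ → EReal}
    {Q : ℝ → ℝ → ℝ → ℝ} {N : ℝ → ℝ → ℝ}
    (hmax : ∀ ε, 0 ≤ ε → IsMaximalSolution Φ K (q ε) (τs ε) (Q ε) (N ε)) :
    τs 0 ≤ liminf τs (𝓝[>] 0) := by
  refine le_of_forall_lt fun c hc => ?_
  obtain ⟨T, hcT, hT⟩ := EReal.lt_iff_exists_real_btwn.1 (max_lt hc (hmax 0 le_rfl).1.T_pos)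
  have hT0 : 0 ≤ T := by exact_mod_cast ((le_max_right _ _).trans hcT.le)
  refine ((le_max_left _ _).trans_lt hcT).trans_le (le_liminf_of_le (by isBoundedDefault) ?_)
  filter_upwards [eventually_close_of_tendstoC1 hΦ hKΦ hK hq hqt hmax hT0 hT one_pos] with ε h
  exact h.1.le

theorem tendstoUniformlyOn_activity {Φ M : ℝ} {K : ℝ → ℝ} (hΦ : 0 ≤ Φ)
    (hKΦ : IsPhaseResponse Φ K) (hK : IsBoundedC2 K M) {q : ℝ → ℝ → ℝ}
    (hq : ∀ ε, 0 ≤ ε → IsAdmissibleData Φ K (q ε)) (hqt : TendstoC1 q (q 0)) {τs : ℝ → EReal}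
    {Q : ℝ → ℝ → ℝ → ℝ} {N : ℝ → ℝ → ℝ}
    (hmax : ∀ ε, 0 ≤ ε → IsMaximalSolution Φ K (q ε) (τs ε) (Q ε) (N ε))
    {T : ℝ} (hT : 0 ≤ T) (hTs : (T : EReal) < τs 0) :
    TendstoUniformlyOn N (N 0) (𝓝[>] 0) (Icc 0 T) := by
  have h0 := (hmax 0 le_rfl).1
  have hsub := Icc_subset_timeInterval hTs
  obtain ⟨t, ht, hmaxN⟩ := (isCompact_Icc (a := 0) (b := T)).exists_isMaxOn (nonempty_Icc.2 hT)
    (h0.continuousOn.mono hsub)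
  obtain ⟨B, hB⟩ : ∃ B, B = N 0 t := ⟨_, rfl⟩
  have hB0 : 0 < B := hB ▸ h0.N_pos t (hsub ht)
  rw [Metric.tendstoUniformlyOn_iff]
  intro e he
  -- The first bound keeps 1/N_ε ≥ 1/(2B), hence N_ε ≤ 2B. The second then gives |N_0 - N_ε| = N_0
  -- N_ε |1/N_ε - 1/N_0| ≤ e/2.
  have hd : 0 < min (1 / (2 * B)) (e / (4 * B ^ 2)) := by positivity
  filter_upwards [eventually_close_of_tendstoC1 hΦ hKΦ hK hq hqt hmax hT hTs hd,
    self_mem_nhdsWithin] with ε h hε τ hτ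
  have hN0 := h0.N_pos τ (hsub hτ)
  have hNε := (hmax ε (le_of_lt hε)).1.N_pos τ (Icc_subset_timeInterval h.1 hτ)
  have hNB : N 0 τ ≤ B := hB ▸ hmaxN hτ
  have h1 := (h.2 τ hτ).1
  obtain ⟨a, ha⟩ : ∃ a, a = 1 / N ε τ := ⟨_, rfl⟩
  obtain ⟨b, hb⟩ : ∃ b, b = 1 / N 0 τ := ⟨_, rfl⟩
  have hbB : 1 / B ≤ b := hb ▸ one_div_le_one_div_of_le hN0 hNB
  rw [← ha, ← hb] at h1
  have h2 := h1.trans (min_le_left _ _)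
  have h3 := h1.trans (min_le_right _ _)
  have h12 : 1 / (2 * B) = 1 / B / 2 := by field_simp
  have haB : 1 / (2 * B) ≤ a := by
    have := (abs_le.1 h2).1
    linarith
  have hB2 : 0 < 1 / (2 * B) := by positivity
  have hNε' : N ε τ ≤ 2 * B := by
    rw [ha] at haB
    exact (one_div_le_one_div (by positivity) hNε).1 haB
  have hdist : dist (N 0 τ) (N ε τ) = N 0 τ * N ε τ * |a - b| := by
    have : N 0 τ - N ε τ = N 0 τ * N ε τ * (a - b) := by
      rw [ha, hb]
      field_simp
    rw [Real.dist_eq, this, abs_mul, abs_of_pos (mul_pos hN0 hNε)]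
  rw [hdist]
  calc N 0 τ * N ε τ * |a - b| ≤ B * (2 * B) * (e / (4 * B ^ 2)) := by gcongr
    _ = e / 2 := by field_simp; norm_num
    _ < e := by linarith

theorem tendstoC1_solution {Φ M : ℝ} {K : ℝ → ℝ} (hΦ : 0 ≤ Φ)
    (hKΦ : IsPhaseResponse Φ K) (hK : IsBoundedC2 K M) {q : ℝ → ℝ → ℝ}
    (hq : ∀ ε, 0 ≤ ε → IsAdmissibleData Φ K (q ε)) (hqt : TendstoC1 q (q 0)) {τs : ℝ → EReal}
    {Q : ℝ → ℝ → ℝ → ℝ} {N : ℝ → ℝ → ℝ}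
    (hmax : ∀ ε, 0 ≤ ε → IsMaximalSolution Φ K (q ε) (τs ε) (Q ε) (N ε))
    {T : ℝ} (hT : 0 ≤ T) (hTs : (T : EReal) < τs 0) :
    TendstoC1 (fun ε => Q ε T) (Q 0 T) := by
  constructor <;> rw [Metric.tendstoUniformlyOn_iff] <;> intro e he <;>
    filter_upwards [eventually_close_of_tendstoC1 hΦ hKΦ hK hq hqt hmax hT hTs (half_pos he)]
      with ε h η hη <;> rw [dist_comm, Real.dist_eq]
  · exact ((h.2 T (right_mem_Icc.2 hT)).2 η hη).1.trans_lt (half_lt_self he)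
  · exact ((h.2 T (right_mem_Icc.2 hT)).2 η hη).2.trans_lt (half_lt_self he)

/-! ### Second-order regularity -/

theorem contDiffOn_one_of_hasDerivWithinAt {f g : ℝ → ℝ} {s : Set ℝ} (hs : UniqueDiffOn ℝ s)
    (h : ∀ x ∈ s, HasDerivWithinAt f (g x) s x) (hg : ContinuousOn g s) : ContDiffOn ℝ 1 f s := by
  rw [show (1 : WithTop ℕ∞) = 0 + 1 by simp, contDiffOn_succ_iff_derivWithin hs]
  refine ⟨fun x hx => (h x hx).differentiableWithinAt, by simp, contDiffOn_zero.2 ?_⟩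
  exact hg.congr fun x hx => (h x hx).derivWithin (hs x hx)

theorem ContDiffOn.union_Icc {f : ℝ → ℝ} {a b c : ℝ} (hab : a < b) (hbc : b < c)
    (h₁ : ContDiffOn ℝ 1 f (Icc a b)) (h₂ : ContDiffOn ℝ 1 f (Icc b c))
    (h : derivWithin f (Icc a b) b = derivWithin f (Icc b c) b) : ContDiffOn ℝ 1 f (Icc a c) := by
  classical
  set g : ℝ → ℝ := fun x => if x ≤ b then derivWithin f (Icc a b) x else derivWithin f (Icc b c) x
    with hg
  have hg₁ : ∀ x ∈ Icc a b, g x = derivWithin f (Icc a b) x := fun x hx => if_pos hx.2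
  have hg₂ : ∀ x ∈ Icc b c, g x = derivWithin f (Icc b c) x := by
    intro x hx
    rcases hx.1.eq_or_lt with rfl | hlt
    · rw [← h]; exact if_pos le_rfl
    · exact if_neg (not_le.2 hlt)
  have hU : Icc a c = Icc a b ∪ Icc b c := (Icc_union_Icc_eq_Icc hab.le hbc.le).symm
  refine contDiffOn_one_of_hasDerivWithinAt (uniqueDiffOn_Icc (hab.trans hbc)) (g := g)
    (fun x hx => ?_) ?_
  · rw [hU]
    refine HasDerivWithinAt.union ?_ ?_
    · by_cases hx' : x ∈ Icc a b
      · rw [hg₁ x hx']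
        exact (h₁.differentiableOn (by norm_num) x hx').hasDerivWithinAt
      · exact HasFDerivWithinAt.of_notMem_closure (by rwa [isClosed_Icc.closure_eq])
    · by_cases hx' : x ∈ Icc b c
      · rw [hg₂ x hx']
        exact (h₂.differentiableOn (by norm_num) x hx').hasDerivWithinAt
      · exact HasFDerivWithinAt.of_notMem_closure (by rwa [isClosed_Icc.closure_eq])
  · rw [hU]
    exact ((h₁.continuousOn_derivWithin (uniqueDiffOn_Icc hab) le_rfl).congr hg₁).union_of_isClosed
      ((h₂.continuousOn_derivWithin (uniqueDiffOn_Icc hbc) le_rfl).congr hg₂)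
      isClosed_Icc isClosed_Icc

section

variable {K u q : ℝ → ℝ} {M : ℝ}

/-- At time 0 the function `flowDeriv` is identically 1 in x, so only its time derivative K'(x)
survives. -/
theorem hasFDerivAt_flowDeriv_zero (hK : IsBoundedC2 K M) (hu : Continuous u) (x : ℝ) :
    HasFDerivAt (fun p : ℝ × ℝ => flowDeriv K u p.1 p.2)
      (deriv K x • ContinuousLinearMap.fst ℝ ℝ ℝ) ((0 : ℝ), x) := by
  have h := ((contDiff_flowDeriv hK hu).differentiable (by norm_num) ((0 : ℝ), x)).hasFDerivAt
  set L := fderiv ℝ (fun p : ℝ × ℝ => flowDeriv K u p.1 p.2) ((0 : ℝ), x)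
  have h1 : L (1, 0) = deriv K x := by
    have hl : HasDerivAt (fun s => flowDeriv K u s x) (L (1, 0)) 0 :=
      HasFDerivAt.comp_hasDerivAt_of_eq (l := fun p : ℝ × ℝ => flowDeriv K u p.1 p.2)
        (0 : ℝ) h ((hasDerivAt_id (0 : ℝ)).prodMk (hasDerivAt_const (0 : ℝ) x)) rfl
    have := hl.unique (hasDerivAt_flowDeriv_left hK hu 0 x)
    rwa [flowDeriv_zero, one_mul, flow_zero hK hu] at this
  have h2 : L (0, 1) = 0 := by
    refine (h.comp_hasDerivAt x ((hasDerivAt_const x (0 : ℝ)).prodMk (hasDerivAt_id x))).unique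
      ((hasDerivAt_const x (1 : ℝ)).congr_of_eventuallyEq (Eventually.of_forall fun z => ?_))
    exact flowDeriv_zero K u z
  refine h.congr_fderiv ?_
  ext
  · simpa using h1
  · simpa using h2

theorem contDiffOn_label (hK : IsBoundedC2 K M) (hu : Continuous u)
    (hq : ContDiffOn ℝ 1 q (Icc 0 1)) (hq0 : q 0 = 0) (hc : u 0 + K 0 = dEta q 0) :
    ContDiffOn ℝ 1 (label K u q) (Iic 1) :=
  contDiffOn_one_of_hasDerivWithinAt (uniqueDiffOn_Iic 1)
    (fun _ hy => hasDerivWithinAt_label hK hu hq hq0 hc hy)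
    (continuous_labelDeriv hK hu hq).continuousOn

/-- The inflow at τ sees `labelDeriv` only at 1 - τ, so regularity down to -b gives regularity of u
up to b + 1: one unit of time is gained per round. -/
theorem contDiffOn_inflow {Φ b : ℝ} (hK : IsBoundedC2 K M) (hu : Continuous u)
    (hq : ContDiffOn ℝ 1 q (Icc 0 1)) (hq0 : q 0 = 0) (hc : u 0 + K 0 = dEta q 0)
    (hueq : ∀ τ, 0 ≤ τ → u τ = profileDeriv K u q τ 1 - K Φ)
    (hw : ContDiffOn ℝ 1 (labelDeriv K u q) (Icc (-b) 1)) : ContDiffOn ℝ 1 u (Icc 0 (b + 1)) := by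
  have hsub : ContDiffOn ℝ 1 (fun τ : ℝ => 1 - τ) (Icc 0 (b + 1)) := by fun_prop
  have h1 : ContDiffOn ℝ 1 (fun τ => label K u q (1 - τ)) (Icc 0 (b + 1)) :=
    (contDiffOn_label hK hu hq hq0 hc).comp hsub fun τ hτ => by
      have := hτ.1
      simp only [mem_Iic]; linarith
  have h2 : ContDiffOn ℝ 1 (fun τ => flowDeriv K u τ (label K u q (1 - τ))) (Icc 0 (b + 1)) :=
    (contDiff_flowDeriv hK hu).comp_contDiffOn (contDiffOn_id.prodMk h1)
  have h3 : ContDiffOn ℝ 1 (fun τ => labelDeriv K u q (1 - τ)) (Icc 0 (b + 1)) :=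
    hw.comp hsub fun τ hτ => ⟨by linarith [hτ.2], by linarith [hτ.1]⟩
  exact ((h2.mul h3).sub (contDiffOn_const (c := K Φ))).congr fun τ hτ => hueq τ hτ.1

theorem labelDeriv_of_nonpos (hc : u 0 + K 0 = dEta q 0) {y : ℝ} (hy : y ≤ 0) :
    labelDeriv K u q y = (u (-y) + K 0) / flowDeriv K u (-y) (label K u q y) := by
  rw [labelDeriv, entrySlope_of_nonpos hc hy, entryTime_of_nonpos hy]

theorem contDiffOn_labelDeriv_of_inflow {b : ℝ} (hK : IsBoundedC2 K M) (hu : Continuous u)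
    (hq : ContDiffOn ℝ 1 q (Icc 0 1)) (hq0 : q 0 = 0) (hc : u 0 + K 0 = dEta q 0)
    (huc : ContDiffOn ℝ 1 u (Icc 0 b)) :
    ContDiffOn ℝ 1 (labelDeriv K u q) (Icc (-b) 0) := by
  have hneg : ContDiffOn ℝ 1 (fun y : ℝ => -y) (Icc (-b) 0) := by fun_prop
  have h1 : ContDiffOn ℝ 1 (fun y => u (-y)) (Icc (-b) 0) :=
    huc.comp hneg fun y hy => ⟨by linarith [hy.2], by linarith [hy.1]⟩
  have h2 : ContDiffOn ℝ 1 (fun y => flowDeriv K u (-y) (label K u q y)) (Icc (-b) 0) :=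
    (contDiff_flowDeriv hK hu).comp_contDiffOn (hneg.prodMk
      ((contDiffOn_label hK hu hq hq0 hc).mono fun y hy => hy.2.trans zero_le_one))
  exact ((h1.add (contDiffOn_const (c := K 0))).div h2
    fun y _ => (flowDeriv_pos K u _ _).ne').congr fun y hy => labelDeriv_of_nonpos hc hy.2

theorem iteratedDerivWithin_two_eq (q : ℝ → ℝ) (x : ℝ) :
    iteratedDerivWithin 2 q (Icc 0 1) x = derivWithin (dEta q) (Icc 0 1) x := by
  rw [iteratedDerivWithin_succ, iteratedDerivWithin_one]
  rfl

/-- The fixed point equation gives u'(0⁺) = K'(Φ) q'(1) - q''(1). The quotient formula for y ≤ 0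
then gives the left derivative -u'(0⁺) + K'(0) q'(0), which equals q''(0) exactly by second-order
compatibility. -/
theorem hasDerivWithinAt_labelDeriv_zero {Φ b : ℝ} (hK : IsBoundedC2 K M) (hu : Continuous u)
    (hq : IsAdmissibleData Φ K q) (hq2 : IsSecondOrderCompatible Φ K q)
    (hc : u 0 + K 0 = dEta q 0)
    (hueq : ∀ τ, 0 ≤ τ → u τ = profileDeriv K u q τ 1 - K Φ)
    (hd : DifferentiableOn ℝ (dEta q) (Icc 0 1)) :
    HasDerivWithinAt (labelDeriv K u q) (derivWithin (dEta q) (Icc 0 1) 0) (Icc (-b) 0) 0 := by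
  have h0mem : (0 : ℝ) ∈ Icc (0 : ℝ) 1 := left_mem_Icc.2 zero_le_one
  have h1mem : (1 : ℝ) ∈ Icc (0 : ℝ) 1 := right_mem_Icc.2 zero_le_one
  have hq1 := hq.contDiffOn
  have hcompat := hq2.compat
  simp only [iteratedDerivWithin_two_eq] at hcompat
  have hdl : ∀ y ≤ 1, HasDerivWithinAt (label K u q) (labelDeriv K u q y) (Iic 1) y :=
    fun y hy => hasDerivWithinAt_label hK hu hq1 hq.at_zero hc hy
  have hl1 : label K u q 1 = Φ := by rw [label_of_mem hK hu h1mem, hq.at_one]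
  have hl0 : label K u q 0 = 0 := by rw [label_of_mem hK hu h0mem, hq.at_zero]
  have hsub : HasDerivWithinAt (fun τ : ℝ => 1 - τ) (-1) (Icc 0 1) 0 := by
    simpa using (hasDerivWithinAt_id (0 : ℝ) (Icc 0 1)).const_sub 1
  have hu' : HasDerivWithinAt u
      (deriv K Φ * dEta q 1 - derivWithin (dEta q) (Icc 0 1) 1) (Ici 0) 0 := by
    have e1 : HasDerivWithinAt (fun τ => label K u q (1 - τ)) (labelDeriv K u q 1 * -1)
        (Icc 0 1) 0 :=
      (hdl 1 le_rfl).comp_of_eq 0 hsub (fun τ hτ => by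
        have := hτ.1
        simp only [mem_Iic]; linarith) (by simp)
    have e2 : HasDerivWithinAt (fun τ => flowDeriv K u τ (label K u q (1 - τ))) (deriv K Φ)
        (Icc 0 1) 0 := by
      have := (hasFDerivAt_flowDeriv_zero hK hu Φ).comp_hasDerivWithinAt_of_eq 0
        ((hasDerivWithinAt_id 0 _).prodMk e1) (by simp [hl1])
      exact this.congr_deriv (by simp)
    have e3 : HasDerivWithinAt (fun τ => dEta q (1 - τ))
        (derivWithin (dEta q) (Icc 0 1) 1 * -1) (Icc 0 1) 0 :=
      (hd 1 h1mem).hasDerivWithinAt.comp_of_eq 0 hsub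
        (fun τ hτ => ⟨by linarith [hτ.2], by linarith [hτ.1]⟩) (by simp)
    have e4 : HasDerivWithinAt u
        (deriv K Φ * dEta q 1 - derivWithin (dEta q) (Icc 0 1) 1) (Icc 0 1) 0 := by
      refine (((e2.fun_mul e3).sub_const (K Φ)).congr_of_mem (fun τ hτ => ?_)
        h0mem).congr_deriv ?_
      · rw [hueq τ hτ.1, profileDeriv,
          labelDeriv_of_mem (y := 1 - τ) ⟨by linarith [hτ.2], by linarith [hτ.1]⟩]
      · simp [flowDeriv_zero]
        ring
    exact e4.mono_of_mem_nhdsWithin (Icc_mem_nhdsGE zero_lt_one)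
  have hneg : HasDerivWithinAt (fun y : ℝ => -y) (-1) (Icc (-b) 0) 0 :=
    (hasDerivAt_neg 0).hasDerivWithinAt
  have e1 : HasDerivWithinAt (fun y => u (-y))
      ((deriv K Φ * dEta q 1 - derivWithin (dEta q) (Icc 0 1) 1) * -1) (Icc (-b) 0) 0 :=
    hu'.comp_of_eq 0 hneg (fun y hy => by have := hy.2; simp only [mem_Ici]; linarith) (by simp)
  have e2 : HasDerivWithinAt (fun y => flowDeriv K u (-y) (label K u q y)) (-deriv K 0)
      (Icc (-b) 0) 0 := by
    have := (hasFDerivAt_flowDeriv_zero hK hu 0).comp_hasDerivWithinAt_of_eq 0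
      (hneg.prodMk ((hdl 0 zero_le_one).mono
        (fun y hy => hy.2.trans zero_le_one : Icc (-b) 0 ⊆ Iic 1))) (by simp [hl0])
    exact this.congr_deriv (by simp)
  refine (((e1.add_const (K 0)).fun_div e2 (flowDeriv_pos K u _ _).ne').congr
    (fun y hy => labelDeriv_of_nonpos hc hy.2) (labelDeriv_of_nonpos hc le_rfl)).congr_deriv ?_
  simp only [neg_zero, flowDeriv_zero, hc]
  linarith

/-- Induction on the number of delays: C¹ on [-n, 1] gives u C¹ on [0, n + 1], hence `labelDeriv` C¹
on [-(n + 1), 0], glued to [0, 1] by the matching derivatives at 0. -/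
theorem contDiffOn_labelDeriv {Φ : ℝ} (hK : IsBoundedC2 K M) (hu : Continuous u)
    (hq : IsAdmissibleData Φ K q) (hq2 : IsSecondOrderCompatible Φ K q)
    (hc : u 0 + K 0 = dEta q 0)
    (hueq : ∀ τ, 0 ≤ τ → u τ = profileDeriv K u q τ 1 - K Φ) (n : ℕ) :
    ContDiffOn ℝ 1 (labelDeriv K u q) (Icc (-n) 1) := by
  have hd : ContDiffOn ℝ 1 (dEta q) (Icc 0 1) :=
    hq2.contDiffOn.derivWithin (uniqueDiffOn_Icc zero_lt_one) (by norm_num)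
  have hw : ContDiffOn ℝ 1 (labelDeriv K u q) (Icc 0 1) :=
    hd.congr fun y hy => labelDeriv_of_mem hy
  induction n with
  | zero => simpa using hw
  | succ n ih =>
    have h1 := contDiffOn_inflow hK hu hq.contDiffOn hq.at_zero hc hueq ih
    have h2 := contDiffOn_labelDeriv_of_inflow hK hu hq.contDiffOn hq.at_zero hc h1
    have hn : -((n : ℝ) + 1) < 0 := by have : (0 : ℝ) ≤ n := n.cast_nonneg; linarith
    rw [Nat.cast_succ]
    refine h2.union_Icc hn zero_lt_one hw ?_
    rw [(hasDerivWithinAt_labelDeriv_zero hK hu hq hq2 hc hueq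
      (hd.differentiableOn (by norm_num))).derivWithin
      (uniqueDiffOn_Icc hn 0 (right_mem_Icc.2 hn.le))]
    exact (derivWithin_congr (fun y hy => labelDeriv_of_mem hy)
      (labelDeriv_of_mem (left_mem_Icc.2 zero_le_one))).symm

theorem contDiffOn_labelDeriv_Iic {Φ : ℝ} (hK : IsBoundedC2 K M) (hu : Continuous u)
    (hq : IsAdmissibleData Φ K q) (hq2 : IsSecondOrderCompatible Φ K q)
    (hc : u 0 + K 0 = dEta q 0)
    (hueq : ∀ τ, 0 ≤ τ → u τ = profileDeriv K u q τ 1 - K Φ) :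
    ContDiffOn ℝ 1 (labelDeriv K u q) (Iic 1) := by
  intro y hy
  obtain ⟨n, hn⟩ := exists_nat_gt (-y)
  refine (contDiffOn_labelDeriv hK hu hq hq2 hc hueq n y
    ⟨by linarith, hy⟩).mono_of_mem_nhdsWithin ?_
  rw [← Ici_inter_Iic]
  exact inter_mem (mem_nhdsWithin_of_mem_nhds (Ici_mem_nhds (by linarith))) self_mem_nhdsWithin
end

section

variable {K u q : ℝ → ℝ} {M : ℝ}

theorem contDiffOn_inflow_Ici {Φ : ℝ} (hK : IsBoundedC2 K M) (hu : Continuous u)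
    (hq : IsAdmissibleData Φ K q) (hq2 : IsSecondOrderCompatible Φ K q)
    (hc : u 0 + K 0 = dEta q 0)
    (hueq : ∀ τ, 0 ≤ τ → u τ = profileDeriv K u q τ 1 - K Φ) : ContDiffOn ℝ 1 u (Ici 0) := by
  intro τ hτ
  obtain ⟨n, hn⟩ := exists_nat_gt τ
  refine (contDiffOn_inflow hK hu hq.contDiffOn hq.at_zero hc hueq
    (contDiffOn_labelDeriv hK hu hq hq2 hc hueq n) τ
    ⟨hτ, by linarith⟩).mono_of_mem_nhdsWithin ?_
  rw [← Ici_inter_Iic]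
  exact inter_mem self_mem_nhdsWithin (mem_nhdsWithin_of_mem_nhds (Iic_mem_nhds (by linarith)))

/-- Both first partials are C¹: the slope is a product of C¹ factors, and the time derivative is u +
K(Q) minus the slope. -/
theorem contDiffOn_two_profile {Φ : ℝ} (hK : IsBoundedC2 K M) (hu : Continuous u)
    (hq : IsAdmissibleData Φ K q) (hq2 : IsSecondOrderCompatible Φ K q)
    (hc : u 0 + K 0 = dEta q 0)
    (hueq : ∀ τ, 0 ≤ τ → u τ = profileDeriv K u q τ 1 - K Φ) :
    ContDiffOn ℝ 2 (fun p : ℝ × ℝ => profile K u q p.1 p.2) (Ici 0 ×ˢ Icc 0 1) := by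
  set s : Set (ℝ × ℝ) := Ici 0 ×ˢ Icc 0 1 with hs
  have hmaps : MapsTo (fun p : ℝ × ℝ => p.2 - p.1) s (Iic 1) := fun p hp => by
    have h1 : 0 ≤ p.1 := hp.1
    have h2 := hp.2.2
    simp only [mem_Iic]; linarith
  have hsub : ContDiffOn ℝ 1 (fun p : ℝ × ℝ => p.2 - p.1) s := by fun_prop
  have hl : ContDiffOn ℝ 1 (fun p : ℝ × ℝ => (p.1, label K u q (p.2 - p.1))) s :=
    contDiffOn_fst.prodMk
      ((contDiffOn_label hK hu hq.contDiffOn hq.at_zero hc).comp hsub hmaps)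
  have hP : ContDiffOn ℝ 1 (fun p : ℝ × ℝ => profileDeriv K u q p.1 p.2) s :=
    ((contDiff_flowDeriv hK hu).comp_contDiffOn hl).mul
      ((contDiffOn_labelDeriv_Iic hK hu hq hq2 hc hueq).comp hsub hmaps)
  have hQ : ContDiffOn ℝ 1 (fun p : ℝ × ℝ => profile K u q p.1 p.2) s :=
    (contDiff_flow hK hu).comp_contDiffOn hl
  have hu1 : ContDiffOn ℝ 1 (fun p : ℝ × ℝ => u p.1) s :=
    (contDiffOn_inflow_Ici hK hu hq hq2 hc hueq).comp contDiffOn_fst fun p hp => hp.1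
  have hK1 : ContDiff ℝ 1 K := hK.contDiff.of_le (by norm_num)
  have := contDiffOn_succ_of_partials (n := 1)
    ((uniqueDiffOn_Ici 0).prod (uniqueDiffOn_Icc zero_lt_one))
    (fun p hp => hasFDerivWithinAt_profile_strip hK hu hq.contDiffOn hq.at_zero hc hp)
    ((hu1.add (hK1.comp_contDiffOn hQ)).sub hP) hP
  exact this.of_le (by norm_num)

end

theorem IsMaximalSolution.contDiffOn_two {Φ M : ℝ} {K q : ℝ → ℝ} {τs : EReal} {Q : ℝ → ℝ → ℝ}
    {N : ℝ → ℝ} (h : IsMaximalSolution Φ K q τs Q N) (hΦ : 0 ≤ Φ) (hKΦ : IsPhaseResponse Φ K)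
    (hK : IsBoundedC2 K M) (hq : IsAdmissibleData Φ K q) (hq2 : IsSecondOrderCompatible Φ K q) :
    ContDiffOn ℝ 1 N (timeInterval τs) ∧
      ContDiffOn ℝ 2 (fun p : ℝ × ℝ => Q p.1 p.2) (timeInterval τs ×ˢ Icc 0 1) := by
  obtain ⟨T, u, hu, hc, hueq, hmax, -, -⟩ := exists_maximalSolution hΦ hKΦ hK hq
  obtain rfl := h.time_eq hmax
  have heq := fun τ hτ => h.1.unique hK hq hmax.1 (τ := τ) hτ hτ
  constructor
  · refine ContDiffOn.congr (contDiffOn_const.div ((contDiffOn_inflow_Ici hK hu hq hq2 hc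
      hueq).mono fun τ hτ => hτ.1) fun τ hτ h0 => ?_) fun τ hτ => (heq τ hτ).1
    have := hmax.1.N_pos τ hτ
    simp [h0] at this
  · exact ((contDiffOn_two_profile hK hu hq hq2 hc hueq).mono
      (prod_mono (fun _ h => h.1) subset_rfl)).congr fun p hp => (heq p.1 hp.1).2 p.2 hp.2

theorem theorem3p1 (Φ : ℝ) (hΦ : 0 < Φ) (K : ℝ → ℝ) (hK : IsPhaseResponse Φ K) :
    -- existence, uniqueness, maximal time and blow-up of the firing rate
    (∀ q : ℝ → ℝ, IsAdmissibleData Φ K q →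
      ∃ (τs : EReal) (Q : ℝ → ℝ → ℝ) (N : ℝ → ℝ),
        IsMaximalSolution Φ K q τs Q N ∧
        (∀ (T : EReal) (Q' : ℝ → ℝ → ℝ) (N' : ℝ → ℝ), IsClassicalSolution Φ K q T Q' N' →
          ∀ τ ∈ timeInterval T, N' τ = N τ ∧ ∀ η ∈ Icc (0 : ℝ) 1, Q' τ η = Q τ η) ∧
        (τs < ⊤ → Tendsto N (𝓝[<] τs.toReal) atTop)) ∧
    -- continuous dependence on the initial data
    (∀ q : ℝ → ℝ → ℝ, (∀ ε, 0 ≤ ε → IsAdmissibleData Φ K (q ε)) → TendstoC1 q (q 0) →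
      ∀ (τs : ℝ → EReal) (Q : ℝ → ℝ → ℝ → ℝ) (N : ℝ → ℝ → ℝ),
        (∀ ε, 0 ≤ ε → IsMaximalSolution Φ K (q ε) (τs ε) (Q ε) (N ε)) →
        τs 0 ≤ liminf τs (𝓝[>] 0) ∧
        ∀ T : ℝ, 0 < T → (T : EReal) < τs 0 →
          TendstoUniformlyOn N (N 0) (𝓝[>] 0) (Icc 0 T) ∧
          TendstoC1 (fun ε => Q ε T) (Q 0 T)) ∧
    -- second-order regularity
    (∀ q : ℝ → ℝ, IsAdmissibleData Φ K q → IsSecondOrderCompatible Φ K q →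
      ∀ (τs : EReal) (Q : ℝ → ℝ → ℝ) (N : ℝ → ℝ), IsMaximalSolution Φ K q τs Q N →
        ContDiffOn ℝ 1 N (timeInterval τs) ∧
        ContDiffOn ℝ 2 (fun p : ℝ × ℝ => Q p.1 p.2) (timeInterval τs ×ˢ Icc 0 1)) := by
  obtain ⟨M, hM⟩ := hK.exists_isBoundedC2
  refine ⟨fun q hq => ?_, fun q hq hqt τs Q N hmax => ?_, fun q hq hq2 τs Q N h =>
    h.contDiffOn_two hΦ.le hK hM hq hq2⟩
  · obtain ⟨τs, u, -, -, -, hmax, hblow, -⟩ := exists_maximalSolution hΦ.le hK hM hq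
    refine ⟨τs, _, _, hmax, fun T Q' N' h' τ hτ => ?_, hblow⟩
    exact h'.unique hM hq hmax.1 hτ ⟨hτ.1, hτ.2.trans_le (hmax.2 T Q' N' h')⟩
  · exact ⟨le_liminf_existenceTime hΦ.le hK hM hq hqt hmax, fun T hT hTs =>
      ⟨tendstoUniformlyOn_activity hΦ.le hK hM hq hqt hmax hT.le hTs,
        tendstoC1_solution hΦ.le hK hM hq hqt hmax hT.le hTs⟩⟩
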